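/- Let $P$ be a finite set (of qubits), let $V=\mathbb F_2\oplus\mathbb F_2$ with standard basis $(z,x)$ and symplectic form $\omega$, and equip $V^P$ with the sum of these forms. Let $L\subset V^P$ be an isotropic subspace (that is, $\omega|_{L\times L}=0$). For $S\subset P$ let $V^S\subset V^P$ be the space of vectors vanishing outside $S$ and put $L_S=L\cap V^S$; we say that $L$ splits off $L_S$ if $L=L_S\times L_{P\setminus S}$. A zero factor is a split-off $L_S=0$ with $S\neq\emptyset$; a Bell Lagrangian is a split-off $L_S$ with $|S|=2$ that is Lagrangian in $V^S$ (isotropic of dimension $|S|$) and indecomposable (not of the form $L_T\times L_{S\setminus T}$ with $\emptyset\ne T\subsetneq S$). Let the Pauli group be the group of operators on $(\mathbb C^2)^{\otimes P}$ formed by the products of a scalar of absolute value one and a tensor product of Pauli operators, with its projection to $V^P$ ($Z\mapsto z$, $X\mapsto x$), and let $\sigma$ be a homomorphic section of this projection over $L$. Let $C(L,\sigma)=\{\psi\in(\mathbb C^2)^{\otimes P}\mid\sigma(v)\psi=\psi\text{ for all }v\in L\}$ be the stabilizer code, and let $$A(L,\sigma)=\Bigl\{g\in SO(3)^P\ \Big|\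 \bigl(\textstyle\bigotimes_{p}\tilde g_p\bigr)C(L,\sigma)\subset C(L,\sigma)\text{ for some }\tilde g\in U(2)^P\text{ representing }g\Bigr\}$$ be its automorphism group, where $U(2)/S^1=SO(3)$ via the adjoint action on traceless Hermitian operators (with basis $X,Y,Z$). If $L$ splits off no zero factor and no Bell Lagrangian then, for every such $\sigma$, the group $A(L,\sigma)$, with the topology induced from $SO(3)^P$, is a solvable compact Lie group. Moreover $A(L,\sigma)$ is a closed subgroup of $SO(3)^P$ contained in a product $\prod_{p\in P}G_p$ in which each $G_p\subset SO(3)$ is either the octahedral group generated by the rotations by a right angle around the three coordinate axes, or one of the three infinite dihedral groups $D_a$, $a\in\{x,y,z\}$, generated by all rotations around the $a$ axis and one rotation by 180 degrees around an orthogonal coordinate axis. -/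

import Mathlib

open scoped Matrix Manifold ContDiff

noncomputable section

namespace Stabilizer

/-! ### The symplectic side -/

/-- The binary plane `V = 𝔽₂ ⊕ 𝔽₂`, with standard basis `z = (1, 0)`, `x = (0, 1)`. -/
abbrev V : Type := ZMod 2 × ZMod 2

/-- The symplectic form on `V ^ P`: the sum over the qubits of the symplectic form of `V`. -/
def omega {P : Type*} [Fintype P] (v w : P → V) : ZMod 2 :=
  ∑ p, ((v p).1 * (w p).2 - (v p).2 * (w p).1)

/-- A subspace is isotropic if the symplectic form vanishes identically on it. -/
def IsIsotropic {P : Type*} [Fintype P] (L : Submodule (ZMod 2) (P → V)) : Prop :=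
  ∀ v ∈ L, ∀ w ∈ L, omega v w = 0

/-- The subspace `V ^ S` of `V ^ P`: the vectors supported in `S`. -/
def supportedIn {P : Type*} (S : Set P) : Submodule (ZMod 2) (P → V) where
  carrier := {v | ∀ p, p ∉ S → v p = 0}
  add_mem' := fun ha hb p hp => by simp [ha p hp, hb p hp]
  zero_mem' := fun _ _ => rfl
  smul_mem' := fun c v hv p hp => by simp [hv p hp]

/-- `L_S = L ∩ V ^ S`. -/
def part {P : Type*} (L : Submodule (ZMod 2) (P → V)) (S : Set P) :
    Submodule (ZMod 2) (P → V) :=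
  L ⊓ supportedIn S

/-- `L` is the direct product of `L_S` and `L_{P ∖ S}`, so `L_S` is a direct factor of `L`.
(The sum is automatically direct, as the supports are disjoint.) -/
def SplitsOff {P : Type*} (L : Submodule (ZMod 2) (P → V)) (S : Set P) : Prop :=
  L = part L S ⊔ part L Sᶜ

/-- `L_S`, as a subspace of `V ^ S`, is not a direct product `L_T × L_{S ∖ T}` with
`∅ ≠ T ≠ S`. -/
def IsIndecomposable {P : Type*} (L : Submodule (ZMod 2) (P → V)) (S : Set P) : Prop :=
  ∀ T : Set P, T ⊆ S → T.Nonempty → T ≠ S → part L S ≠ part L T ⊔ part L (S \ T)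

/-- `L_S`, as a subspace of `V ^ S`, is Lagrangian: isotropic of dimension `|S|`. -/
def IsLagrangianOn {P : Type*} [Fintype P] (L : Submodule (ZMod 2) (P → V)) (S : Set P) :
    Prop :=
  IsIsotropic (part L S) ∧ Module.finrank (ZMod 2) (part L S) = S.ncard

/-- `L` has a direct factor that is zero, over a non-empty set of qubits. -/
def HasZeroFactor {P : Type*} (L : Submodule (ZMod 2) (P → V)) : Prop :=
  ∃ S : Set P, S.Nonempty ∧ SplitsOff L S ∧ part L S = ⊥

/-- `L` has a direct factor that is an indecomposable Lagrangian over two qubits. -/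
def HasBellFactor {P : Type*} [Fintype P] (L : Submodule (ZMod 2) (P → V)) : Prop :=
  ∃ S : Set P, S.ncard = 2 ∧ SplitsOff L S ∧ IsLagrangianOn L S ∧ IsIndecomposable L S

/-! ### Local operators and Pauli operators -/

/-- Operators on `ℋ^{⊗P}`, `ℋ = ℂ²`, as matrices in the computational basis, which is indexed by
the bit strings `P → Fin 2`. A state is its amplitude function `(P → Fin 2) → ℂ`. -/
abbrev Op (P : Type*) : Type _ := Matrix (P → Fin 2) (P → Fin 2) ℂ

/-- The tensor product `⨂ₚ Aₚ` of one-qubit operators. -/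
def tensorOp {P : Type*} [Fintype P] (A : P → Matrix (Fin 2) (Fin 2) ℂ) : Op P :=
  Matrix.of fun i j => ∏ p, A p (i p) (j p)

/-- `tensorOp` acts on product states factor by factor. -/
theorem tensorOp_mulVec {P : Type*} [Fintype P] [DecidableEq P]
    (A : P → Matrix (Fin 2) (Fin 2) ℂ) (φ : P → Fin 2 → ℂ) :
    tensorOp A *ᵥ (fun i => ∏ p, φ p (i p)) = fun i => ∏ p, (A p *ᵥ φ p) (i p) := by
  ext i
  simp only [Matrix.mulVec, dotProduct, tensorOp, Matrix.of_apply, ← Finset.prod_mul_distrib]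
  rw [Fintype.prod_sum (fun p a => A p (i p) a * φ p a)]

theorem tensorOp_mul {P : Type*} [Fintype P] [DecidableEq P]
    (A B : P → Matrix (Fin 2) (Fin 2) ℂ) :
    tensorOp A * tensorOp B = tensorOp fun p => A p * B p := by
  ext i k
  simp only [Matrix.mul_apply, tensorOp, Matrix.of_apply, ← Finset.prod_mul_distrib]
  rw [Fintype.prod_sum (fun p a => A p (i p) a * B p a (k p))]

theorem tensorOp_one {P : Type*} [Fintype P] [DecidableEq P] :
    tensorOp (fun _ : P => 1) = 1 := by
  ext i j
  simp only [tensorOp, Matrix.of_apply, Matrix.one_apply, Finset.prod_ite_zero, Finset.prod_const_one,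
    Finset.mem_univ, true_implies, funext_iff]

/-- The Pauli matrices `X`, `Y`, `Z`, in this order. -/
def pauli : Fin 3 → Matrix (Fin 2) (Fin 2) ℂ :=
  ![!![0, 1; 1, 0], !![0, -Complex.I; Complex.I, 0], !![1, 0; 0, -1]]

/-- A Pauli operator representing `v ∈ V`: `z ↦ Z`, `x ↦ X`, and `z + x ↦ Z X = i Y`. -/
def pauliOp (v : V) : Matrix (Fin 2) (Fin 2) ℂ :=
  pauli 2 ^ v.1.val * pauli 0 ^ v.2.val

/-- `U` is an element of the Pauli group (the tensor products of Pauli operators times arbitrary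
scalars of absolute value one) that projects to `v ∈ V ^ P`. -/
def IsPauliOver {P : Type*} [Fintype P] (v : P → V) (U : Op P) : Prop :=
  ∃ c : ℂ, ‖c‖ = 1 ∧ U = c • tensorOp fun p => pauliOp (v p)

/-- A homomorphic section over `L` of the projection from the Pauli group to `V ^ P`. -/
structure PauliSection {P : Type*} [Fintype P] [DecidableEq P]
    (L : Submodule (ZMod 2) (P → V)) where
  toHom : Multiplicative L →* Op P
  isPauliOver : ∀ v : L, IsPauliOver (v : P → V) (toHom (Multiplicative.ofAdd v))

/-- The stabilizer code `C(L, σ)`: the common fixed space of all `σ(v)`, `v ∈ L`. -/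
def code {P : Type*} [Fintype P] [DecidableEq P] {L : Submodule (ZMod 2) (P → V)}
    (σ : PauliSection L) : Submodule ℂ ((P → Fin 2) → ℂ) where
  carrier := {ψ | ∀ v : L, σ.toHom (Multiplicative.ofAdd v) *ᵥ ψ = ψ}
  add_mem' := fun ha hb v => by rw [Matrix.mulVec_add, ha v, hb v]
  zero_mem' := fun v => Matrix.mulVec_zero _
  smul_mem' := fun c ψ hψ v => by rw [Matrix.mulVec_smul, hψ v]

/-! ### The automorphism group -/

abbrev U2 : Type := Matrix.unitaryGroup (Fin 2) ℂ

abbrev SO3 : Type := Matrix.specialOrthogonalGroup (Fin 3) ℝ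

/-- `u ∈ U(2)` represents `g ∈ SO(3)`: the matrix of the adjoint action of `u` on the traceless
Hermitian operators, with respect to their basis `X, Y, Z`, is `g`. -/
def Represents (u : U2) (g : SO3) : Prop :=
  ∀ j, (u : Matrix (Fin 2) (Fin 2) ℂ) * pauli j * (u : Matrix (Fin 2) (Fin 2) ℂ)ᴴ =
    ∑ i, (((g : Matrix (Fin 3) (Fin 3) ℝ) i j : ℝ) : ℂ) • pauli i

theorem Represents.one : Represents 1 1 := by
  intro j
  simp [Matrix.one_apply]

theorem Represents.mul {u u' : U2} {g g' : SO3} (h : Represents u g) (h' : Represents u' g') :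
    Represents (u * u') (g * g') := by
  intro j
  have e : ((u * u' : U2) : Matrix (Fin 2) (Fin 2) ℂ) * pauli j *
      ((u * u' : U2) : Matrix (Fin 2) (Fin 2) ℂ)ᴴ =
      (u : Matrix (Fin 2) (Fin 2) ℂ) * ((u' : Matrix (Fin 2) (Fin 2) ℂ) * pauli j *
        (u' : Matrix (Fin 2) (Fin 2) ℂ)ᴴ) * (u : Matrix (Fin 2) (Fin 2) ℂ)ᴴ := by
    simp only [Submonoid.coe_mul, Matrix.conjTranspose_mul, Matrix.mul_assoc]
  rw [e, h' j]
  simp only [Matrix.mul_sum, Matrix.sum_mul, Matrix.mul_smul, Matrix.smul_mul]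
  simp only [h _, Finset.smul_sum, Submonoid.coe_mul, Matrix.mul_apply, smul_smul]
  rw [Finset.sum_comm]
  refine Finset.sum_congr rfl fun k _ => ?_
  rw [← Finset.sum_smul]
  push_cast
  simp only [mul_comm]

theorem Represents.inv {u : U2} {g : SO3} (h : Represents u g) : Represents u⁻¹ g⁻¹ := by
  intro j
  have hu : (u : Matrix (Fin 2) (Fin 2) ℂ)ᴴ * (u : Matrix (Fin 2) (Fin 2) ℂ) = 1 :=
    Matrix.UnitaryGroup.star_mul_self u
  have hi : ((u⁻¹ : U2) : Matrix (Fin 2) (Fin 2) ℂ) = (u : Matrix (Fin 2) (Fin 2) ℂ)ᴴ := rfl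
  have hg : (g : Matrix (Fin 3) (Fin 3) ℝ) * ((g⁻¹ : SO3) : Matrix (Fin 3) (Fin 3) ℝ) = 1 := by
    rw [← Submonoid.coe_mul, mul_inv_cancel, Submonoid.coe_one]
  set M : Matrix (Fin 2) (Fin 2) ℂ :=
    ∑ i, ((((g⁻¹ : SO3) : Matrix (Fin 3) (Fin 3) ℝ) i j : ℝ) : ℂ) • pauli i with hM
  have key : pauli j = (u : Matrix (Fin 2) (Fin 2) ℂ) * M * (u : Matrix (Fin 2) (Fin 2) ℂ)ᴴ := by
    simp only [hM, Matrix.mul_sum, Matrix.sum_mul, Matrix.mul_smul, Matrix.smul_mul, h _,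
      Finset.smul_sum, smul_smul]
    rw [Finset.sum_comm]
    simp only [← Finset.sum_smul]
    have hk : ∀ k, ∑ i, (((((g⁻¹ : SO3) : Matrix (Fin 3) (Fin 3) ℝ) i j : ℝ) : ℂ) *
        (((g : Matrix (Fin 3) (Fin 3) ℝ) k i : ℝ) : ℂ)) = if k = j then 1 else 0 := by
      intro k
      have := congrFun (congrFun hg k) j
      rw [Matrix.mul_apply, Matrix.one_apply] at this
      have h2 := congrArg (fun r : ℝ => (r : ℂ)) this
      simp only [Complex.ofReal_sum, Complex.ofReal_mul] at h2
      refine (Finset.sum_congr rfl fun i _ => mul_comm _ _).trans (h2.trans ?_)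
      split_ifs <;> simp
    simp only [hk]
    simp
  rw [hi, Matrix.conjTranspose_conjTranspose, key]
  calc _ = ((u : Matrix (Fin 2) (Fin 2) ℂ)ᴴ * (u : Matrix (Fin 2) (Fin 2) ℂ)) * M *
        ((u : Matrix (Fin 2) (Fin 2) ℂ)ᴴ * (u : Matrix (Fin 2) (Fin 2) ℂ)) := by
        simp only [Matrix.mul_assoc]
    _ = M := by rw [hu]; simp

/-- The automorphism group `A(L, σ)`: all `g ∈ SO(3) ^ P` such that some family of unitaries
representing `g` sends the code into itself. -/
def autGroup {P : Type*} [Fintype P] [DecidableEq P] {L : Submodule (ZMod 2) (P → V)}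
    (σ : PauliSection L) : Subgroup (P → SO3) where
  carrier := {g | ∃ u : P → U2, (∀ p, Represents (u p) (g p)) ∧
    ∀ ψ ∈ code σ, tensorOp (fun p => (u p : Matrix (Fin 2) (Fin 2) ℂ)) *ᵥ ψ ∈ code σ}
  one_mem' := ⟨1, fun _ => Represents.one, fun ψ hψ => by
    simpa [tensorOp_one] using hψ⟩
  mul_mem' := by
    rintro g g' ⟨u, hu, hc⟩ ⟨u', hu', hc'⟩
    refine ⟨u * u', fun p => (hu p).mul (hu' p), fun ψ hψ => ?_⟩
    have := hc _ (hc' ψ hψ)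
    rw [Matrix.mulVec_mulVec, tensorOp_mul] at this
    simpa using this
  inv_mem' := by
    rintro g ⟨u, hu, hc⟩
    refine ⟨u⁻¹, fun p => (hu p).inv, fun ψ hψ => ?_⟩
    have hinv : tensorOp (fun p => ((u⁻¹ : P → U2) p : Matrix (Fin 2) (Fin 2) ℂ)) *
        tensorOp (fun p => (u p : Matrix (Fin 2) (Fin 2) ℂ)) = 1 := by
      rw [tensorOp_mul, ← tensorOp_one]
      congr 1
      funext p
      rw [Pi.inv_apply, ← Submonoid.coe_mul, inv_mul_cancel, Submonoid.coe_one]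
    let f : code σ →ₗ[ℂ] code σ :=
      (Matrix.mulVecLin (tensorOp (fun p => (u p : Matrix (Fin 2) (Fin 2) ℂ)))).restrict hc
    have hf : Function.Injective f := by
      intro a b hab
      have h0 : tensorOp (fun p => (u p : Matrix (Fin 2) (Fin 2) ℂ)) *ᵥ (a : (P → Fin 2) → ℂ) =
          tensorOp (fun p => (u p : Matrix (Fin 2) (Fin 2) ℂ)) *ᵥ (b : (P → Fin 2) → ℂ) :=
        congrArg Subtype.val hab
      have h1 := congrArg (fun c =>
        tensorOp (fun p => ((u⁻¹ : P → U2) p : Matrix (Fin 2) (Fin 2) ℂ)) *ᵥ c) h0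
      simp only [Matrix.mulVec_mulVec, hinv, Matrix.one_mulVec] at h1
      exact Subtype.ext h1
    obtain ⟨φ, hφ⟩ := (LinearMap.injective_iff_surjective.mp hf) ⟨ψ, hψ⟩
    have h2 : tensorOp (fun p => (u p : Matrix (Fin 2) (Fin 2) ℂ)) *ᵥ (φ : (P → Fin 2) → ℂ) = ψ :=
      congrArg Subtype.val hφ
    rw [← h2, Matrix.mulVec_mulVec, hinv, Matrix.one_mulVec]
    exact φ.2

/-! ### Octahedral and dihedral subgroups of `SO(3)` -/

/-- The matrix of the rotation by the angle `θ` around the `x`, `y`, `z` axis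
(`a = 0, 1, 2` respectively). -/
def axisRotMatrix (a : Fin 3) (θ : ℝ) : Matrix (Fin 3) (Fin 3) ℝ :=
  ![!![1, 0, 0; 0, Real.cos θ, -Real.sin θ; 0, Real.sin θ, Real.cos θ],
    !![Real.cos θ, 0, Real.sin θ; 0, 1, 0; -Real.sin θ, 0, Real.cos θ],
    !![Real.cos θ, -Real.sin θ, 0; Real.sin θ, Real.cos θ, 0; 0, 0, 1]] a

theorem axisRotMatrix_mem (a : Fin 3) (θ : ℝ) :
    axisRotMatrix a θ ∈ Matrix.specialOrthogonalGroup (Fin 3) ℝ := by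
  have h := Real.sin_sq_add_cos_sq θ
  rw [Matrix.mem_specialOrthogonalGroup_iff, Matrix.mem_orthogonalGroup_iff]
  constructor
  · ext i j
    fin_cases a <;> fin_cases i <;> fin_cases j <;>
      simp [axisRotMatrix, Matrix.mul_apply, Fin.sum_univ_three] <;> nlinarith [h]
  · fin_cases a <;> simp [axisRotMatrix, Matrix.det_fin_three] <;> nlinarith [h]

/-- The rotation by the angle `θ` around the axis `a`. -/
def axisRot (a : Fin 3) (θ : ℝ) : SO3 := ⟨axisRotMatrix a θ, axisRotMatrix_mem a θ⟩

/-- The octahedral group, generated by the rotations by a right angle around the three axes. -/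
def octahedral : Subgroup SO3 :=
  Subgroup.closure (Set.range fun a : Fin 3 => axisRot a (Real.pi / 2))

/-- The infinite dihedral group `D_a`, generated by all rotations around the axis `a` and one
rotation by `180` degrees around an orthogonal axis. -/
def dihedral (a : Fin 3) : Subgroup SO3 :=
  Subgroup.closure ((Set.range fun θ : ℝ => axisRot a θ) ∪ {axisRot (a + 1) Real.pi})

end Stabilizer

/-- The topological group `G`, with its given topology, is a compact real (smooth,
finite-dimensional) Lie group. -/
def IsCompactLieGroup (G : Type*) [Group G] [TopologicalSpace G] : Prop :=
  CompactSpace G ∧ T2Space G ∧ ∃ (n : ℕ) (_ : ChartedSpace (EuclideanSpace ℝ (Fin n)) G),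
    LieGroup (𝓡 n) ∞ G

end

open Stabilizer

/-!
The conjugate of a Pauli operator by `⨂ u p` has a nonzero coefficient at a Pauli operator exactly
if all the corresponding entries of the rotations `g p` are nonzero, since the coefficients of a
tensor product are products. The projection to the code is the mean of the stabilizers `σ v`, and
conjugation by an automorphism preserves it; so if exactly one `v ∈ L` contributes at `w`, the
contribution cannot cancel, and `w ∈ L`.

Let `S` be a minimal support of the elements of `L` that are nonzero at a qubit `p`. All elements of
`L` supported in `S` either take proportional values at `p`, or evaluation at every `q ∈ S`
identifies them with `V`. In the first case, replacing `g` by its component at `p` alone shows that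
`g p` preserves the axis of that value. In the second case `S` has at least three elements, since
`L` splits off neither a zero factor nor a Bell Lagrangian; two different nonzero entries in one row
of `g p` could then be combined with the entries at the other qubits of `S` to an element of `L`
vanishing at some but not all of `S`, so `g p` is a signed permutation matrix.

A closed subgroup of a product of octahedral and dihedral groups is solvable, and near the identity
it consists of rotations around fixed axes. The angles form a closed subgroup of a vector space,
which near zero is a linear subspace; it provides the charts of a Lie group.
-/

noncomputable section

namespace Stabilizer

/-! ### Orthogonal matrices -/

section Orthogonal

variable {n : Type*} [Fintype n] [DecidableEq n]

section Rows

variable {R : Type*} [CommRing R] {A : Matrix n n R}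

theorem transpose_mem_orthogonalGroup (hA : A ∈ Matrix.orthogonalGroup n R) :
    Aᵀ ∈ Matrix.orthogonalGroup n R :=
  (Matrix.mem_orthogonalGroup_iff n R).2 ((Matrix.mem_orthogonalGroup_iff' n R).1 hA)

theorem sum_sq_row (hA : A ∈ Matrix.orthogonalGroup n R) (i : n) : ∑ j, A i j ^ 2 = 1 := by
  have h : (A * Aᵀ) i i = 1 := by
    rw [(Matrix.mem_orthogonalGroup_iff n R).1 hA, Matrix.one_apply_eq]
  simpa only [Matrix.mul_apply, Matrix.transpose_apply, ← sq] using h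

theorem sum_sq_col (hA : A ∈ Matrix.orthogonalGroup n R) (j : n) : ∑ i, A i j ^ 2 = 1 :=
  sum_sq_row (transpose_mem_orthogonalGroup hA) j

theorem sq_entry_eq_one_of_row (hA : A ∈ Matrix.orthogonalGroup n R) {i j : n}
    (h : ∀ k, k ≠ j → A i k = 0) : A i j ^ 2 = 1 := by
  rw [← sum_sq_row hA i, Finset.sum_eq_single j (fun k _ hk => by rw [h k hk, sq, zero_mul])
    (by simp)]

variable [LinearOrder R] [IsStrictOrderedRing R]

theorem row_eq_zero (hA : A ∈ Matrix.orthogonalGroup n R) {i j k : n} (h : A i j ^ 2 = 1)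
    (hk : k ≠ j) : A i k = 0 := by
  have hle : ∑ l ∈ {j, k}, A i l ^ 2 ≤ ∑ l, A i l ^ 2 :=
    Finset.sum_le_sum_of_subset_of_nonneg (Finset.subset_univ _) fun l _ _ => sq_nonneg _
  rw [sum_sq_row hA, Finset.sum_pair hk.symm, h, add_le_iff_nonpos_right] at hle
  exact pow_eq_zero_iff two_ne_zero |>.1 (hle.antisymm (sq_nonneg _))

theorem col_eq_zero (hA : A ∈ Matrix.orthogonalGroup n R) {i j k : n} (h : A j i ^ 2 = 1)
    (hk : k ≠ j) : A k i = 0 :=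
  row_eq_zero (transpose_mem_orthogonalGroup hA) h hk

theorem sq_entry_le_one (hA : A ∈ Matrix.orthogonalGroup n R) (i j : n) : A i j ^ 2 ≤ 1 := by
  rw [← sum_sq_row hA i]
  exact Finset.single_le_sum (f := fun k => A i k ^ 2) (fun k _ => sq_nonneg _)
    (Finset.mem_univ j)

theorem exists_entry_ne_zero (hA : A ∈ Matrix.orthogonalGroup n R) (j : n) :
    ∃ i, A i j ≠ 0 := by
  by_contra! h
  simpa [h] using sum_sq_col hA j

theorem mul_entry_self_of_sq_eq_one (hA : A ∈ Matrix.orthogonalGroup n R) {a : n}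
    (h : A a a ^ 2 = 1) (B : Matrix n n R) : (A * B) a a = A a a * B a a :=
  (Matrix.mul_apply ..).trans <|
    Finset.sum_eq_single a (fun k _ hk => by rw [row_eq_zero hA h hk, zero_mul]) (by simp)

end Rows

/-- The group of rotations with integral matrix entries; for `n = Fin 3` this is the octahedral
group. -/
def integralSO (n : Type*) [Fintype n] [DecidableEq n] :
    Subgroup (Matrix.specialOrthogonalGroup n ℝ) where
  carrier := {g | ∀ i j, ∃ m : ℤ, g.1 i j = m}
  one_mem' := fun i j => ⟨(1 : Matrix n n ℤ) i j, by simp [Matrix.one_apply]⟩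
  mul_mem' := by
    intro g h hg hh i j
    choose a ha using hg
    choose b hb using hh
    exact ⟨∑ k, a i k * b k j, by simp [Matrix.mul_apply, ha, hb]⟩
  inv_mem' := fun hg i j => hg j i

/-- The group of rotations that preserve the coordinate axis `a`, up to orientation. For `n = Fin 3`
this is the infinite dihedral group `D_a`. -/
def axisStabilizer (a : n) : Subgroup (Matrix.specialOrthogonalGroup n ℝ) where
  carrier := {g | g.1 a a ^ 2 = 1}
  one_mem' := by simp
  mul_mem' := by
    intro g h hg hh
    rw [Set.mem_ofPred_eq] at hg hh ⊢
    rw [Submonoid.coe_mul, mul_entry_self_of_sq_eq_one g.2.1 hg, mul_pow, hg, hh, one_mul]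
  inv_mem' := fun hg => hg

variable {g : Matrix.specialOrthogonalGroup n ℝ}

theorem mem_axisStabilizer_iff {a : n} : g ∈ axisStabilizer a ↔ g.1 a a ^ 2 = 1 := Iff.rfl

theorem mem_axisStabilizer_of_col {a : n} (h : ∀ b, b ≠ a → g.1 b a = 0) :
    g ∈ axisStabilizer a :=
  sq_entry_eq_one_of_row (transpose_mem_orthogonalGroup g.2.1) h

theorem entry_of_mem_integralSO (hg : g ∈ integralSO n) (i j : n) :
    g.1 i j = 0 ∨ g.1 i j ^ 2 = 1 := by
  obtain ⟨m, hm⟩ := hg i j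
  have hsq : m ^ 2 ≤ 1 := by
    exact_mod_cast hm ▸ sq_entry_le_one g.2.1 i j
  obtain ⟨hlo, hhi⟩ := abs_le.1 (sq_le_one_iff_abs_le_one m |>.1 hsq)
  rw [hm]
  interval_cases m <;> simp

theorem mem_integralSO_of_row (h : ∀ i j k, j ≠ k → g.1 i j * g.1 i k = 0) :
    g ∈ integralSO n := by
  intro i j
  by_cases hij : g.1 i j = 0
  · exact ⟨0, by simp [hij]⟩
  have hsq := sq_entry_eq_one_of_row g.2.1 (i := i) (j := j) fun k hk =>
    (mul_eq_zero.1 (h i j k hk.symm)).resolve_left hij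
  rcases sq_eq_one_iff.1 hsq with h | h
  · exact ⟨1, by simp [h]⟩
  · exact ⟨-1, by simp [h]⟩

theorem exists_sq_entry_eq_one (hg : g ∈ integralSO n) (j : n) : ∃ i, g.1 i j ^ 2 = 1 :=
  (exists_entry_ne_zero g.2.1 j).imp fun i hi => (entry_of_mem_integralSO hg i j).resolve_left hi

end Orthogonal

/-! ### Rotations of three-dimensional space -/

section Rotation

theorem eq_or_eq_add_one_or_eq_add_two (a i : Fin 3) : i = a ∨ i = a + 1 ∨ i = a + 2 := by
  decide +revert

@[to_additive]
theorem prod_fin_three_shift {M : Type*} [CommMonoid M] (a : Fin 3) (f : Fin 3 → M) :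
    ∏ i, f i = f a * f (a + 1) * f (a + 2) := by
  rw [Fin.prod_univ_three]
  fin_cases a
  · rfl
  · exact (mul_assoc _ _ _).trans (mul_comm _ _)
  · exact (mul_comm _ _).trans (mul_assoc _ _ _).symm

theorem eq_one_of_diag {g : SO3} (a : Fin 3) (h₀ : g.1 a a = 1)
    (h₁ : g.1 (a + 1) (a + 1) = 1) : g = 1 := by
  have hsq₀ : g.1 a a ^ 2 = 1 := by rw [h₀, one_pow]
  have hsq₁ : g.1 (a + 1) (a + 1) ^ 2 = 1 := by rw [h₁, one_pow]
  have hdiag : g.1 = Matrix.diagonal fun i => g.1 i i := by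
    ext i j
    rcases eq_or_ne i j with rfl | hij
    · rw [Matrix.diagonal_apply_eq]
    rw [Matrix.diagonal_apply_ne _ hij]
    have haxis : i = a ∨ i = a + 1 ∨ j = a ∨ j = a + 1 := by
      clear hsq₀ hsq₁ h₀ h₁; decide +revert
    rcases haxis with rfl | rfl | rfl | rfl
    · exact row_eq_zero g.2.1 hsq₀ hij.symm
    · exact row_eq_zero g.2.1 hsq₁ hij.symm
    · exact col_eq_zero g.2.1 hsq₀ hij
    · exact col_eq_zero g.2.1 hsq₁ hij
  have h₂ : g.1 (a + 2) (a + 2) = 1 := by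
    have hdet : g.1.det = 1 := (Matrix.mem_specialOrthogonalGroup_iff.1 g.2).2
    rwa [hdiag, Matrix.det_diagonal, prod_fin_three_shift a, h₀, h₁, one_mul, one_mul] at hdet
  refine Subtype.ext (hdiag.trans ?_)
  rw [Submonoid.coe_one, ← Matrix.diagonal_one]
  congr 1
  funext i
  rcases eq_or_eq_add_one_or_eq_add_two a i with rfl | rfl | rfl
  exacts [h₀, h₁, h₂]

theorem axisRot_entry_self (a : Fin 3) (θ : ℝ) : (axisRot a θ).1 a a = 1 := by
  fin_cases a <;> simp [axisRot, axisRotMatrix]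

theorem axisRot_entry_cos (a : Fin 3) (θ : ℝ) :
    (axisRot a θ).1 (a + 1) (a + 1) = Real.cos θ := by
  fin_cases a <;> simp [axisRot, axisRotMatrix]

theorem axisRot_entry_sin (a : Fin 3) (θ : ℝ) :
    (axisRot a θ).1 (a + 2) (a + 1) = Real.sin θ := by
  fin_cases a <;> simp [axisRot, axisRotMatrix]

theorem entry_succ_eq_zero {a : Fin 3} {g : SO3} (h : g.1 a a = 1) : g.1 a (a + 1) = 0 :=
  row_eq_zero g.2.1 (by rw [h, one_pow]) (by clear h; decide +revert)

theorem sq_add_sq_entry_succ {a : Fin 3} {g : SO3} (h : g.1 a a = 1) :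
    g.1 (a + 1) (a + 1) ^ 2 + g.1 (a + 2) (a + 1) ^ 2 = 1 := by
  rw [← sum_sq_col g.2.1 (a + 1), sum_fin_three_shift a, entry_succ_eq_zero h, sq (0 : ℝ),
    zero_mul, zero_add]

theorem eq_axisRot {a : Fin 3} {g : SO3} {θ : ℝ} (h : g.1 a a = 1)
    (hcos : g.1 (a + 1) (a + 1) = Real.cos θ) (hsin : g.1 (a + 2) (a + 1) = Real.sin θ) :
    g = axisRot a θ := by
  have hinv : ∀ b, ((axisRot a θ)⁻¹ * g).1 b b = ∑ i, (axisRot a θ).1 i b * g.1 i b :=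
    fun _ => rfl
  refine (inv_mul_eq_one.1 (eq_one_of_diag a ?_ ?_)).symm
  · rw [hinv, Finset.sum_eq_single a _ (by simp), axisRot_entry_self, h, one_mul]
    intro i _ hi
    rw [col_eq_zero g.2.1 (by rw [h, one_pow]) hi, mul_zero]
  · rw [hinv, sum_fin_three_shift a, entry_succ_eq_zero h, mul_zero, zero_add, hcos, hsin,
      axisRot_entry_cos, axisRot_entry_sin, ← sq, ← sq, Real.cos_sq_add_sin_sq]

theorem axisRot_add (a : Fin 3) (θ η : ℝ) : axisRot a (θ + η) = axisRot a θ * axisRot a η := by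
  refine Subtype.ext (Matrix.ext fun i j => ?_)
  rw [Submonoid.coe_mul, Matrix.mul_apply, Fin.sum_univ_three]
  fin_cases a <;> fin_cases i <;> fin_cases j <;>
    simp [axisRot, axisRotMatrix, Real.cos_add, Real.sin_add] <;> ring

/-- The one-parameter group of the rotations around the coordinate axis `a`. -/
def axisRotHom (a : Fin 3) : Multiplicative ℝ →* SO3 :=
  MonoidHom.mk' (fun θ => axisRot a θ.toAdd) fun θ η => axisRot_add a θ.toAdd η.toAdd

theorem axisRot_int_mul (a : Fin 3) (k : ℤ) (θ : ℝ) : axisRot a (k * θ) = axisRot a θ ^ k := by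
  rw [← zsmul_eq_mul]
  exact map_zpow (axisRotHom a) (Multiplicative.ofAdd θ) k

/-! #### Integral rotations are octahedral -/

theorem octahedral_le_integralSO : octahedral ≤ integralSO (Fin 3) := by
  rw [octahedral, Subgroup.closure_le]
  rintro _ ⟨a, rfl⟩
  refine mem_integralSO_of_row fun i j k hjk => ?_
  fin_cases a <;> fin_cases i <;> fin_cases j <;> fin_cases k <;>
    simp [axisRot, axisRotMatrix] at hjk ⊢

theorem axisRot_int_mul_mem_octahedral (a : Fin 3) (k : ℤ) :
    axisRot a (k * (Real.pi / 2)) ∈ octahedral := by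
  rw [axisRot_int_mul]
  exact zpow_mem (Subgroup.subset_closure (Set.mem_range_self a)) k

theorem exists_int_angle {c s : ℝ} (h : c ^ 2 = 1 ∧ s = 0 ∨ c = 0 ∧ s ^ 2 = 1) :
    ∃ k : ℤ, Real.cos (k * (Real.pi / 2)) = c ∧ Real.sin (k * (Real.pi / 2)) = s := by
  rcases h with ⟨hc, rfl⟩ | ⟨rfl, hs⟩
  · rcases sq_eq_one_iff.1 hc with rfl | rfl
    · exact ⟨0, by simp⟩
    · exact ⟨2, by simp [mul_div_cancel₀]⟩
  · rcases sq_eq_one_iff.1 hs with rfl | rfl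
    · exact ⟨1, by simp⟩
    · exact ⟨-1, by simp⟩

theorem mem_octahedral_of_entry_self {a : Fin 3} {g : SO3} (hg : g ∈ integralSO (Fin 3))
    (h : g.1 a a = 1) : g ∈ octahedral := by
  have hsq := sq_add_sq_entry_succ h
  obtain ⟨k, hcos, hsin⟩ := exists_int_angle
    (c := g.1 (a + 1) (a + 1)) (s := g.1 (a + 2) (a + 1)) <| by
      rcases entry_of_mem_integralSO hg (a + 1) (a + 1) with hc | hc
      · rw [hc, sq (0 : ℝ), zero_mul, zero_add] at hsq
        exact Or.inr ⟨hc, hsq⟩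
      · rw [hc, add_eq_left] at hsq
        exact Or.inl ⟨hc, pow_eq_zero_iff two_ne_zero |>.1 hsq⟩
  rw [eq_axisRot h hcos.symm hsin.symm]
  exact axisRot_int_mul_mem_octahedral a k

theorem exists_mem_octahedral_entry_zero (i : Fin 3) {ε : ℝ} (hε : ε ^ 2 = 1) :
    ∃ r ∈ octahedral, r.1 i 0 = ε := by
  obtain ⟨k, hcos, hsin⟩ : ∃ k : ℤ, Real.cos (k * (Real.pi / 2)) = (if i = 0 then ε else 0) ∧
      Real.sin (k * (Real.pi / 2)) = (if i = 0 then 0 else if i = 1 then ε else -ε) :=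
    exists_int_angle (by fin_cases i <;> simp [hε])
  refine ⟨_, axisRot_int_mul_mem_octahedral (if i = 2 then 1 else 2) k, ?_⟩
  fin_cases i <;> simp_all [axisRot, axisRotMatrix]

theorem octahedral_eq_integralSO : octahedral = integralSO (Fin 3) := by
  refine octahedral_le_integralSO.antisymm fun g hg => ?_
  obtain ⟨i, hi⟩ := exists_sq_entry_eq_one hg 0
  obtain ⟨r, hr, hri⟩ := exists_mem_octahedral_entry_zero i hi
  have hcol : ∀ j, j ≠ i → r.1 j 0 = 0 := fun j hj => col_eq_zero r.2.1 (hri ▸ hi) hj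
  have hentry : (r⁻¹ * g).1 0 0 = 1 := by
    change ∑ j, r.1 j 0 * g.1 j 0 = 1
    rw [Finset.sum_eq_single i (fun j _ hj => by rw [hcol j hj, zero_mul]) (by simp), hri, ← sq, hi]
  exact (Subgroup.mul_mem_cancel_left _ (inv_mem hr)).1 <|
    mem_octahedral_of_entry_self (mul_mem (octahedral_le_integralSO (inv_mem hr)) hg) hentry

/-! #### Rotations that preserve an axis are dihedral -/

/-- The angle in `(-π, π]` of a rotation around the axis `a`, as a function on all of `SO(3)`. -/
def axisAngle (a : Fin 3) (g : SO3) : ℝ :=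
  Complex.arg ⟨g.1 (a + 1) (a + 1), g.1 (a + 2) (a + 1)⟩

theorem axisRot_axisAngle {a : Fin 3} {g : SO3} (h : g.1 a a = 1) :
    axisRot a (axisAngle a g) = g := by
  set z : ℂ := ⟨g.1 (a + 1) (a + 1), g.1 (a + 2) (a + 1)⟩
  have hnorm : ‖z‖ = 1 := by
    rw [Complex.norm_def, Complex.normSq_mk, Real.sqrt_eq_one, ← sq, ← sq, sq_add_sq_entry_succ h]
  have hz₀ : z ≠ 0 := norm_ne_zero_iff.1 (hnorm ▸ one_ne_zero)
  refine (eq_axisRot h ?_ ?_).symm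
  · rw [axisAngle, Complex.cos_arg hz₀, hnorm, div_one]
  · rw [axisAngle, Complex.sin_arg, hnorm, div_one]

theorem axisRot_pi_mul (a : Fin 3) (θ : ℝ) :
    axisRot (a + 1) Real.pi * axisRot a θ = axisRot a (-θ) * axisRot (a + 1) Real.pi := by
  refine Subtype.ext (Matrix.ext fun i j => ?_)
  rw [Submonoid.coe_mul, Submonoid.coe_mul, Matrix.mul_apply, Matrix.mul_apply, Fin.sum_univ_three,
    Fin.sum_univ_three]
  fin_cases a <;> fin_cases i <;> fin_cases j <;> simp [axisRot, axisRotMatrix]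

theorem axisRot_pi_entry (a : Fin 3) : (axisRot (a + 1) Real.pi).1 a a = -1 := by
  fin_cases a <;> simp [axisRot, axisRotMatrix]

theorem axisStabilizer_cases {a : Fin 3} {g : SO3} (hg : g ∈ axisStabilizer a) :
    (g.1 a a = 1 ∧ ∃ θ, g = axisRot a θ) ∨
      (g.1 a a = -1 ∧ ∃ θ, g = axisRot a θ * axisRot (a + 1) Real.pi) := by
  rcases sq_eq_one_iff.1 hg with h | h
  · exact Or.inl ⟨h, _, (axisRot_axisAngle h).symm⟩
  · have hentry : (g * (axisRot (a + 1) Real.pi)⁻¹).1 a a = 1 := by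
      refine (mul_entry_self_of_sq_eq_one g.2.1 hg _).trans ?_
      rw [h, neg_one_mul, neg_eq_iff_eq_neg]
      exact axisRot_pi_entry a
    exact Or.inr ⟨h, _, by rw [axisRot_axisAngle hentry, inv_mul_cancel_right]⟩

theorem dihedral_eq_axisStabilizer (a : Fin 3) : dihedral a = axisStabilizer a := by
  apply le_antisymm
  · rw [dihedral, Subgroup.closure_le]
    rintro _ (⟨θ, rfl⟩ | rfl)
    · exact mem_axisStabilizer_iff.2 (by rw [axisRot_entry_self, one_pow])
    · exact mem_axisStabilizer_iff.2 (by rw [axisRot_pi_entry, neg_one_sq])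
  · intro g hg
    have hrot : ∀ θ, axisRot a θ ∈ dihedral a := fun θ =>
      Subgroup.subset_closure (Or.inl ⟨θ, rfl⟩)
    rcases axisStabilizer_cases hg with ⟨-, θ, rfl⟩ | ⟨-, θ, rfl⟩
    · exact hrot θ
    · exact mul_mem (hrot θ) (Subgroup.subset_closure (Or.inr rfl))

theorem mul_axisRot {a : Fin 3} {g : SO3} (hg : g ∈ axisStabilizer a) (θ : ℝ) :
    g * axisRot a θ = axisRot a (g.1 a a * θ) * g := by
  rcases axisStabilizer_cases hg with ⟨h, η, hη⟩ | ⟨h, η, hη⟩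
  · rw [h, hη, one_mul, ← axisRot_add, ← axisRot_add, add_comm]
  · rw [h, hη, mul_assoc, axisRot_pi_mul, ← mul_assoc, ← mul_assoc, ← axisRot_add, ← axisRot_add,
      neg_one_mul, add_comm]

end Rotation

/-! ### Solvability -/

section Solvable

theorem isSolvable_of_hom {G H : Type*} [Group G] [Group H] [Group.IsSolvable H] (f : G →* H)
    (hf : ∀ x y, f x = 1 → f y = 1 → x * y = y * x) : Group.IsSolvable G := by
  have : Group.IsSolvable f.ker :=
    Group.isSolvable_of_comm fun x y => Subtype.ext (hf x y x.2 y.2)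
  exact Group.isSolvable_of_ker_le_range f.ker.subtype f (by simp)

theorem isSolvable_of_le_pi {ι : Type*} [Finite ι] {H : ι → Type*} [∀ i, Group (H i)]
    {G : ∀ i, Subgroup (H i)} (hG : ∀ i, Group.IsSolvable (G i)) {A : Subgroup (∀ i, H i)}
    (hA : A ≤ Subgroup.pi Set.univ G) : Group.IsSolvable A := by
  have := Fintype.ofFinite ι
  choose n hn using fun i => (hG i).solvable
  refine ⟨⟨Finset.univ.sup n, (Subgroup.eq_bot_iff_forall _).2 fun g hg =>
    Subtype.ext (funext fun i => ?_)⟩⟩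
  let f : A →* G i :=
    ((Pi.evalMonoidHom H i).comp A.subtype).codRestrict (G i) fun g => hA g.2 i (Set.mem_univ i)
  have hfg : f g ∈ derivedSeries (G i) (n i) :=
    map_derivedSeries_le_derivedSeries f _ <| Subgroup.mem_map_of_mem f <|
      derivedSeries_antitone A (Finset.le_sup (Finset.mem_univ i)) hg
  rw [hn i, Subgroup.mem_bot] at hfg
  exact congrArg Subtype.val hfg

theorem isSolvable_axisStabilizer (a : Fin 3) : Group.IsSolvable (axisStabilizer a) := by
  let χ : axisStabilizer a →* ℝ :=
    { toFun g := g.1.1 a a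
      map_one' := Matrix.one_apply_eq a
      map_mul' g h := mul_entry_self_of_sq_eq_one g.1.2.1 g.2 h.1.1 }
  refine isSolvable_of_hom χ.toHomUnits fun g h hg hh => Subtype.ext ?_
  have hg' : g.1.1 a a = 1 := congrArg Units.val hg
  have hh' : h.1.1 a a = 1 := congrArg Units.val hh
  rw [Subgroup.coe_mul, Subgroup.coe_mul, ← axisRot_axisAngle hg', ← axisRot_axisAngle hh',
    ← axisRot_add, ← axisRot_add, add_comm]

theorem isSolvable_perm_fin_three : Group.IsSolvable (Equiv.Perm (Fin 3)) :=
  isSolvable_of_hom Equiv.Perm.sign (by decide)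

section Integral

variable {n : Type*} [Fintype n] [DecidableEq n]

/-- The coordinate axis to which an integral rotation sends the axis `j`. -/
def axisImage (g : integralSO n) (j : n) : n :=
  (exists_sq_entry_eq_one g.2 j).choose

theorem axisImage_spec (g : integralSO n) (j : n) : g.1.1 (axisImage g j) j ^ 2 = 1 :=
  (exists_sq_entry_eq_one g.2 j).choose_spec

theorem axisImage_eq_iff {g : integralSO n} {i j : n} :
    axisImage g j = i ↔ g.1.1 i j ≠ 0 := by
  refine ⟨?_, fun h => ?_⟩
  · rintro rfl h
    simpa [h] using axisImage_spec g j
  · by_contra hne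
    exact h (col_eq_zero g.1.2.1 (axisImage_spec g j) (Ne.symm hne))

/-- The action of the integral rotations on the coordinate axes. -/
@[reducible]
def axisAction (n : Type*) [Fintype n] [DecidableEq n] : MulAction (integralSO n) n where
  smul := axisImage
  one_smul j := axisImage_eq_iff.2 (by simp)
  mul_smul g h j := axisImage_eq_iff.2 <| by
    change ∑ k, g.1.1 (axisImage g (axisImage h j)) k * h.1.1 k j ≠ 0
    rw [Finset.sum_eq_single (axisImage h j) _ (by simp)]
    · exact mul_ne_zero (axisImage_eq_iff.1 rfl) (axisImage_eq_iff.1 rfl)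
    · intro k _ hk
      rw [col_eq_zero h.1.2.1 (axisImage_spec h j) hk, mul_zero]

theorem isSolvable_integralSO [Group.IsSolvable (Equiv.Perm n)] :
    Group.IsSolvable (integralSO n) := by
  let := axisAction n
  have hdiag : ∀ k : integralSO n, MulAction.toPermHom (integralSO n) n k = 1 →
      k.1.1 = Matrix.diagonal fun i => k.1.1 i i := by
    intro k hk
    ext i j
    rcases eq_or_ne i j with rfl | hij
    · rw [Matrix.diagonal_apply_eq]
    · have hfix : axisImage k j = j := congrArg (fun e : Equiv.Perm n => e j) hk
      rw [Matrix.diagonal_apply_ne _ hij]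
      by_contra hne
      exact hij ((axisImage_eq_iff.2 hne).symm.trans hfix)
  refine isSolvable_of_hom (MulAction.toPermHom (integralSO n) n) fun g h hg hh =>
    Subtype.ext (Subtype.ext ?_)
  change g.1.1 * h.1.1 = h.1.1 * g.1.1
  rw [hdiag g hg, hdiag h hh, Matrix.diagonal_mul_diagonal, Matrix.diagonal_mul_diagonal]
  simp only [mul_comm]

end Integral

theorem isSolvable_octahedral : Group.IsSolvable octahedral := by
  have := isSolvable_perm_fin_three
  rw [octahedral_eq_integralSO]
  exact isSolvable_integralSO

theorem isSolvable_dihedral (a : Fin 3) : Group.IsSolvable (dihedral a) := by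
  rw [dihedral_eq_axisStabilizer]
  exact isSolvable_axisStabilizer a

end Solvable

/-! ### Pauli operators and conjugation by unitaries -/

section Pauli

/-- The vector `x`, `z + x`, `z` of `V` over which the Pauli matrix `X`, `Y`, `Z` lies. -/
def axisVec : Fin 3 → V := ![(0, 1), (1, 1), (1, 0)]

theorem axisVec_ne_zero (i : Fin 3) : axisVec i ≠ 0 := by decide +revert

theorem axisVec_injective : Function.Injective axisVec := by decide

theorem exists_axisVec {v : V} (hv : v ≠ 0) : ∃ i, axisVec i = v := by decide +revert

/-- The Hermitian Pauli operator `1`, `X`, `Y`, `Z` over `v ∈ V`. In contrast to `pauliOp`, it is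
Hermitian over `z + x` too. -/
def hermPauli (v : V) : Matrix (Fin 2) (Fin 2) ℂ :=
  if v = 0 then 1 else if v = (0, 1) then pauli 0 else if v = (1, 1) then pauli 1 else pauli 2

theorem hermPauli_zero : hermPauli 0 = 1 := rfl

theorem hermPauli_axisVec (i : Fin 3) : hermPauli (axisVec i) = pauli i := by
  fin_cases i <;> simp [hermPauli, axisVec, Prod.ext_iff]

theorem trace_pauli (i : Fin 3) : (pauli i).trace = 0 := by
  fin_cases i <;> simp [pauli, Matrix.trace_fin_two]

theorem trace_pauli_mul_pauli (i j : Fin 3) :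
    (pauli i * pauli j).trace = if i = j then 2 else 0 := by
  fin_cases i <;> fin_cases j <;> simp [pauli, Matrix.trace_fin_two] <;> norm_num

theorem trace_hermPauli (v : V) : (hermPauli v).trace = if v = 0 then 2 else 0 := by
  split_ifs with h
  · simp [h, hermPauli_zero]
  · obtain ⟨i, rfl⟩ := exists_axisVec h
    rw [hermPauli_axisVec, trace_pauli]

theorem trace_hermPauli_mul (v w : V) :
    (hermPauli v * hermPauli w).trace = if v = w then 2 else 0 := by
  rcases eq_or_ne v 0 with rfl | hv
  · simp only [hermPauli_zero, one_mul, trace_hermPauli, eq_comm]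
  rcases eq_or_ne w 0 with rfl | hw
  · rw [hermPauli_zero, mul_one, trace_hermPauli]
  obtain ⟨i, rfl⟩ := exists_axisVec hv
  obtain ⟨j, rfl⟩ := exists_axisVec hw
  simp only [hermPauli_axisVec, trace_pauli_mul_pauli, axisVec_injective.eq_iff]

theorem pauliOp_zero : pauliOp 0 = 1 := by simp [pauliOp]

theorem exists_pauliOp_axisVec_eq_smul (i : Fin 3) :
    ∃ k : ℂ, k ≠ 0 ∧ pauliOp (axisVec i) = k • pauli i := by
  fin_cases i
  · exact ⟨1, one_ne_zero, by simp [pauliOp, axisVec, ZMod.val_one]⟩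
  · refine ⟨Complex.I, Complex.I_ne_zero, ?_⟩
    ext a b
    fin_cases a <;> fin_cases b <;> simp [pauliOp, axisVec, pauli, ZMod.val_one]
  · exact ⟨1, one_ne_zero, by simp [pauliOp, axisVec, ZMod.val_one]⟩

theorem exists_pauliOp_eq_smul (v : V) : ∃ k : ℂ, k ≠ 0 ∧ pauliOp v = k • hermPauli v := by
  rcases eq_or_ne v 0 with rfl | hv
  · exact ⟨1, one_ne_zero, by rw [pauliOp_zero, hermPauli_zero, one_smul]⟩
  · obtain ⟨i, rfl⟩ := exists_axisVec hv
    rw [hermPauli_axisVec]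
    exact exists_pauliOp_axisVec_eq_smul i

theorem pauli_mem_unitaryGroup (i : Fin 3) : pauli i ∈ Matrix.unitaryGroup (Fin 2) ℂ := by
  rw [Matrix.mem_unitaryGroup_iff]
  ext a b
  fin_cases i <;> fin_cases a <;> fin_cases b <;> simp [pauli, Matrix.mul_apply]

theorem pauliOp_mem_unitaryGroup (v : V) : pauliOp v ∈ Matrix.unitaryGroup (Fin 2) ℂ :=
  mul_mem (pow_mem (pauli_mem_unitaryGroup 2) _) (pow_mem (pauli_mem_unitaryGroup 0) _)

/-- Twice the coefficient at `w` in the Pauli expansion of the Pauli operator over `v` conjugated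
by `u`. -/
def conjCoeff (u : U2) (w v : V) : ℂ :=
  (hermPauli w * (u.1 * hermPauli v * u.1ᴴ)).trace

theorem conjCoeff_zero_left (u : U2) (v : V) : conjCoeff u 0 v = if v = 0 then 2 else 0 := by
  have hu : u.1ᴴ * u.1 = 1 := Matrix.mem_unitaryGroup_iff'.1 u.2
  rw [conjCoeff, hermPauli_zero, one_mul, Matrix.trace_mul_comm, ← mul_assoc, hu, one_mul,
    trace_hermPauli]

theorem conjCoeff_zero_right (u : U2) (w : V) : conjCoeff u w 0 = if w = 0 then 2 else 0 := by
  have hu : u.1 * u.1ᴴ = 1 := Matrix.mem_unitaryGroup_iff.1 u.2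
  rw [conjCoeff, hermPauli_zero, mul_one, hu, mul_one, trace_hermPauli]

theorem conjCoeff_one_ne_zero_iff {w v : V} : conjCoeff 1 w v ≠ 0 ↔ w = v := by
  simp [conjCoeff, trace_hermPauli_mul]

theorem eq_zero_iff_of_conjCoeff_ne_zero {u : U2} {w v : V} (h : conjCoeff u w v ≠ 0) :
    w = 0 ↔ v = 0 := by
  constructor
  · rintro rfl
    by_contra hv
    exact h (by rw [conjCoeff_zero_left, if_neg hv])
  · rintro rfl
    by_contra hw
    exact h (by rw [conjCoeff_zero_right, if_neg hw])

theorem Represents.conjCoeff_axisVec {u : U2} {g : SO3} (h : Represents u g) (i j : Fin 3) :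
    conjCoeff u (axisVec i) (axisVec j) = 2 * g.1 i j := by
  rw [conjCoeff, hermPauli_axisVec, hermPauli_axisVec, h j, Matrix.mul_sum, Matrix.trace_sum]
  simp only [Matrix.mul_smul, Matrix.trace_smul, trace_pauli_mul_pauli, smul_eq_mul, mul_ite,
    mul_zero]
  rw [Finset.sum_ite_eq, if_pos (Finset.mem_univ i), mul_comm]

theorem Represents.conjCoeff_axisVec_ne_zero_iff {u : U2} {g : SO3} (h : Represents u g)
    {i j : Fin 3} : conjCoeff u (axisVec i) (axisVec j) ≠ 0 ↔ g.1 i j ≠ 0 := by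
  simp [h.conjCoeff_axisVec]

end Pauli

section Tensor

variable {P : Type*} [Fintype P]

theorem trace_tensorOp [DecidableEq P] (A : P → Matrix (Fin 2) (Fin 2) ℂ) :
    (tensorOp A).trace = ∏ p, (A p).trace := by
  simp only [Matrix.trace, Matrix.diag_apply, tensorOp, Matrix.of_apply]
  rw [Fintype.prod_sum (fun p a => A p a a)]

theorem conjTranspose_tensorOp (A : P → Matrix (Fin 2) (Fin 2) ℂ) :
    (tensorOp A)ᴴ = tensorOp fun p => (A p)ᴴ := by
  ext i j
  simp [tensorOp]

theorem tensorOp_smul (k : P → ℂ) (A : P → Matrix (Fin 2) (Fin 2) ℂ) :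
    (tensorOp fun p => k p • A p) = (∏ p, k p) • tensorOp A := by
  ext i j
  simp [tensorOp, Finset.prod_mul_distrib]

variable [DecidableEq P]

theorem tensorOp_mem_unitaryGroup {A : P → Matrix (Fin 2) (Fin 2) ℂ}
    (hA : ∀ p, A p ∈ Matrix.unitaryGroup (Fin 2) ℂ) :
    tensorOp A ∈ Matrix.unitaryGroup (P → Fin 2) ℂ := by
  rw [Matrix.mem_unitaryGroup_iff, Matrix.star_eq_conjTranspose, conjTranspose_tensorOp,
    tensorOp_mul, ← tensorOp_one]
  congr 1
  funext p
  exact Matrix.mem_unitaryGroup_iff.1 (hA p)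

/-- The unitary operator `⨂ₚ uₚ` on the space of all qubits. -/
def localUnitary : (P → U2) →* Matrix.unitaryGroup (P → Fin 2) ℂ :=
  MonoidHom.mk' (fun u => ⟨_, tensorOp_mem_unitaryGroup fun p => (u p).2⟩) fun _ _ =>
    Subtype.ext (tensorOp_mul _ _).symm

theorem trace_mul_localUnitary_conj (u : P → U2) (w v : P → V) :
    (tensorOp (fun p => hermPauli (w p)) * ((localUnitary u).1 *
      tensorOp (fun p => hermPauli (v p)) * (localUnitary u).1ᴴ)).trace =
      ∏ p, conjCoeff (u p) (w p) (v p) := by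
  change (tensorOp _ * (tensorOp (fun p => (u p).1) * tensorOp _ *
    (tensorOp fun p => (u p).1)ᴴ)).trace = _
  simp only [conjTranspose_tensorOp, tensorOp_mul, trace_tensorOp, conjCoeff]

end Tensor

/-! ### The projection to the stabilizer code -/

section Projection

variable {P : Type*} [Fintype P] [DecidableEq P] {L : Submodule (ZMod 2) (P → V)}

namespace PauliSection

/-- The operator `σ(v)`. -/
def op (σ : PauliSection L) (v : L) : Op P := σ.toHom (Multiplicative.ofAdd v)

theorem op_add (σ : PauliSection L) (v w : L) : σ.op (v + w) = σ.op v * σ.op w :=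
  map_mul σ.toHom _ _

theorem op_zero (σ : PauliSection L) : σ.op 0 = 1 :=
  map_one σ.toHom

theorem op_mul_self (σ : PauliSection L) (v : L) : σ.op v * σ.op v = 1 := by
  rw [← op_add, ZModModule.add_self, op_zero]

theorem op_mul_conjTranspose (σ : PauliSection L) (v : L) : σ.op v * (σ.op v)ᴴ = 1 := by
  obtain ⟨c, hc, h⟩ := σ.isPauliOver v
  have htensor := Matrix.mem_unitaryGroup_iff.1 <|
    tensorOp_mem_unitaryGroup fun p => pauliOp_mem_unitaryGroup (v.1 p)
  rw [op, h, Matrix.conjTranspose_smul, Matrix.smul_mul, Matrix.mul_smul, smul_smul,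
    ← Matrix.star_eq_conjTranspose, htensor, Complex.star_def, Complex.mul_conj,
    Complex.normSq_eq_norm_sq, hc, one_pow, Complex.ofReal_one, one_smul]

theorem isSelfAdjoint_op (σ : PauliSection L) (v : L) : IsSelfAdjoint (σ.op v) := by
  calc (σ.op v)ᴴ = σ.op v * σ.op v * (σ.op v)ᴴ := by rw [op_mul_self, one_mul]
    _ = σ.op v := by rw [mul_assoc, op_mul_conjTranspose, mul_one]

theorem exists_op_eq_smul (σ : PauliSection L) (v : L) :
    ∃ c : ℂ, c ≠ 0 ∧ σ.op v = c • tensorOp fun p => hermPauli (v.1 p) := by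
  obtain ⟨c, hc, h⟩ := σ.isPauliOver v
  choose k hk₀ hk using fun p => exists_pauliOp_eq_smul (v.1 p)
  refine ⟨c * ∏ p, k p, mul_ne_zero ?_ (Finset.prod_ne_zero_iff.2 fun p _ => hk₀ p), ?_⟩
  · exact norm_ne_zero_iff.1 (hc ▸ one_ne_zero)
  · rw [op, h, mul_smul, ← tensorOp_smul]
    simp only [hk]

variable [Fintype L] (σ : PauliSection L)

/-- The orthogonal projection to the stabilizer code, as the average of the operators `σ(v)`. -/
def projection : Op P := (Fintype.card L : ℂ)⁻¹ • ∑ v, σ.op v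

theorem op_mul_projection (v : L) : σ.op v * σ.projection = σ.projection := by
  rw [projection, Matrix.mul_smul, Finset.mul_sum]
  simp only [← op_add]
  rw [Fintype.sum_equiv (Equiv.addLeft v) (fun w => σ.op (v + w)) σ.op fun _ => rfl]

theorem projection_mul {A : Op P} (hA : ∀ v, σ.op v * A = A) : σ.projection * A = A := by
  rw [projection, Matrix.smul_mul, Finset.sum_mul]
  simp only [hA, Finset.sum_const, Finset.card_univ]
  rw [← Nat.cast_smul_eq_nsmul ℂ, inv_smul_smul₀ (Nat.cast_ne_zero.2 Fintype.card_ne_zero)]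

theorem isStarProjection_projection : IsStarProjection σ.projection where
  isIdempotentElem := σ.projection_mul σ.op_mul_projection
  isSelfAdjoint := by
    refine IsSelfAdjoint.smul ?_ (isSelfAdjoint_sum _ fun v _ => σ.isSelfAdjoint_op v)
    simp [IsSelfAdjoint]

theorem projection_mulVec_mem (ψ : (P → Fin 2) → ℂ) : σ.projection *ᵥ ψ ∈ code σ := by
  intro v
  change σ.op v *ᵥ _ = _
  rw [Matrix.mulVec_mulVec, op_mul_projection]

end PauliSection

open scoped ComplexOrder in
theorem eq_of_isStarProjection_of_trace_eq {m : Type*} [Fintype m] {A B : Matrix m m ℂ}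
    (hA : IsStarProjection A) (hB : IsStarProjection B) (hAB : A * B = B)
    (htrace : A.trace = B.trace) : A = B := by
  have hsub : IsStarProjection (A - B) := hB.sub_of_mul_eq_right hA hAB
  have hzero : ((A - B)ᴴ * (A - B)).trace = 0 := by
    rw [← Matrix.star_eq_conjTranspose, hsub.isSelfAdjoint.star_eq, hsub.isIdempotentElem.eq,
      Matrix.trace_sub, htrace, sub_self]
  exact sub_eq_zero.1 (Matrix.trace_conjTranspose_mul_self_eq_zero_iff.1 hzero)

/-- The local unitary operator `⨂ₚ uₚ` sends the code into itself. -/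
def PreservesCode (σ : PauliSection L) (u : P → U2) : Prop :=
  ∀ ψ ∈ code σ, (localUnitary u).1 *ᵥ ψ ∈ code σ

theorem mem_autGroup_iff {σ : PauliSection L} {g : P → SO3} :
    g ∈ autGroup σ ↔ ∃ u : P → U2, (∀ p, Represents (u p) (g p)) ∧ PreservesCode σ u := Iff.rfl

variable {σ : PauliSection L} {u : P → U2}

section Coefficients

variable [Fintype L]

theorem PreservesCode.conj_projection (hu : PreservesCode σ u) :
    (localUnitary u).1 * σ.projection * (localUnitary u).1ᴴ = σ.projection := by
  set U := localUnitary u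
  have hproj := σ.isStarProjection_projection
  have hconj : IsStarProjection (U.1 * σ.projection * U.1ᴴ) :=
    hproj.map (Unitary.conjStarAlgAut ℂ (Op P) U)
  have hfix : ∀ v, σ.op v * (U.1 * σ.projection) = U.1 * σ.projection := by
    refine fun v => Matrix.ext_of_mulVec_single fun i => ?_
    rw [← Matrix.mulVec_mulVec, ← Matrix.mulVec_mulVec]
    exact hu _ (σ.projection_mulVec_mem _) v
  refine (eq_of_isStarProjection_of_trace_eq hproj hconj ?_ ?_).symm
  · rw [← mul_assoc, σ.projection_mul hfix]
  · rw [Matrix.trace_mul_comm, ← mul_assoc, ← Matrix.star_eq_conjTranspose,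
      Matrix.mem_unitaryGroup_iff'.1 U.2, one_mul]

/-- The coefficient of the code projection, conjugated by `⨂ₚ bₚ`, at the Pauli operator over `w`,
multiplied by the dimension of the space of all qubits. -/
def pauliCoeff (σ : PauliSection L) (b : P → U2) (w : P → V) : ℂ :=
  (tensorOp (fun p => hermPauli (w p)) *
    ((localUnitary b).1 * σ.projection * (localUnitary b).1ᴴ)).trace

theorem PreservesCode.pauliCoeff_mul (hu : PreservesCode σ u) (b : P → U2) (w : P → V) :
    pauliCoeff σ (b * u) w = pauliCoeff σ b w := by
  rw [pauliCoeff, pauliCoeff, map_mul, Submonoid.coe_mul, Matrix.conjTranspose_mul]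
  nth_rw 2 [← hu.conj_projection]
  simp only [mul_assoc]

theorem exists_pauliCoeff_eq_sum (σ : PauliSection L) : ∃ c : L → ℂ, (∀ v, c v ≠ 0) ∧
    ∀ b w, pauliCoeff σ b w = ∑ v : L, c v * ∏ p, conjCoeff (b p) (w p) (v.1 p) := by
  choose c hc hop using σ.exists_op_eq_smul
  have hcard : (Fintype.card L : ℂ) ≠ 0 := Nat.cast_ne_zero.2 Fintype.card_ne_zero
  refine ⟨fun v => (Fintype.card L : ℂ)⁻¹ * c v, fun v => mul_ne_zero (inv_ne_zero hcard) (hc v),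
    fun b w => ?_⟩
  simp only [pauliCoeff, PauliSection.projection, hop, Finset.smul_sum, Matrix.mul_sum,
    Matrix.sum_mul, Matrix.trace_sum, smul_smul, Matrix.mul_smul, Matrix.smul_mul,
    Matrix.trace_smul, trace_mul_localUnitary_conj, smul_eq_mul]

end Coefficients

/-- The Pauli operator over `w` occurs in the expansion of the Pauli operator over `v` conjugated
by `⨂ₚ bₚ`. -/
def Occurs (b : P → U2) (w v : P → V) : Prop := ∀ q, conjCoeff (b q) (w q) (v q) ≠ 0

/-- A single occurring term cannot cancel. -/
theorem exists_occurs_of_pauliCoeff_eq [Fintype L] {b b' : P → U2} {w v : P → V}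
    (h : pauliCoeff σ b w = pauliCoeff σ b' w) (hv : v ∈ L) (hocc : Occurs b w v)
    (huniq : ∀ v' ∈ L, Occurs b w v' → v' = v) : ∃ y ∈ L, Occurs b' w y := by
  obtain ⟨c, hc, hsum⟩ := exists_pauliCoeff_eq_sum σ
  have hne : pauliCoeff σ b w ≠ 0 := by
    rw [hsum, Finset.sum_eq_single ⟨v, hv⟩ _ (by simp)]
    · exact mul_ne_zero (hc _) (Finset.prod_ne_zero_iff.2 fun q _ => hocc q)
    · intro v' _ hne
      obtain ⟨q, hq⟩ := not_forall_not.1 <| mt (huniq v'.1 v'.2) fun h => hne (Subtype.ext h)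
      rw [Finset.prod_eq_zero (Finset.mem_univ q) hq, mul_zero]
  rw [h, hsum] at hne
  obtain ⟨y, -, hy⟩ := Finset.exists_ne_zero_of_sum_ne_zero hne
  exact ⟨y.1, y.2, fun q => Finset.prod_ne_zero_iff.1 (right_ne_zero_of_mul hy) q
    (Finset.mem_univ q)⟩

end Projection

/-! ### Minimal supports -/

theorem surjective_and_ker_eq_of_ker_le {K M W : Type*} [DivisionRing K] [AddCommGroup M]
    [Module K M] [AddCommGroup W] [Module K W] [FiniteDimensional K M] [FiniteDimensional K W]
    {f g : M →ₗ[K] W} (hf : Function.Surjective f) (h : LinearMap.ker g ≤ LinearMap.ker f) :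
    Function.Surjective g ∧ LinearMap.ker g = LinearMap.ker f := by
  have hdim := f.finrank_range_add_finrank_ker.trans g.finrank_range_add_finrank_ker.symm
  rw [LinearMap.range_eq_top.2 hf, finrank_top] at hdim
  have hrange := (LinearMap.range g).finrank_le
  have hker := Submodule.finrank_mono h
  refine ⟨LinearMap.range_eq_top.1 <| Submodule.eq_top_of_finrank_eq ?_,
    Submodule.eq_of_le_of_finrank_le h ?_⟩ <;> omega

section Support

variable {P : Type*} {L : Submodule (ZMod 2) (P → V)} {S T : Set P} {p q : P}

theorem mem_part_iff {v : P → V} : v ∈ part L S ↔ v ∈ L ∧ ∀ r, r ∉ S → v r = 0 := Iff.rfl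

theorem part_mono (h : T ⊆ S) : part L T ≤ part L S :=
  fun _ hv => mem_part_iff.2 ⟨hv.1, fun r hr => hv.2 r fun hrT => hr (h hrT)⟩

theorem splitsOff_iff_le : SplitsOff L S ↔ L ≤ part L S ⊔ part L Sᶜ :=
  ⟨le_of_eq, fun h => h.antisymm (sup_le inf_le_left inf_le_left)⟩

theorem exists_apply_ne_zero (hzero : ¬ HasZeroFactor L) (p : P) : ∃ v ∈ L, v p ≠ 0 := by
  by_contra! h
  refine hzero ⟨{p}, Set.singleton_nonempty p, splitsOff_iff_le.2 ?_, ?_⟩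
  · refine le_sup_of_le_right fun v hv => mem_part_iff.2 ⟨hv, fun q hq => ?_⟩
    rw [Set.mem_singleton_iff.1 (Set.notMem_compl_iff.1 hq), h v hv]
  · refine (Submodule.eq_bot_iff _).2 fun v hv => funext fun q => ?_
    by_cases hq : q ∈ ({p} : Set P)
    · exact Set.mem_singleton_iff.1 hq ▸ h v hv.1
    · exact hv.2 q hq

/-- `S` is minimal among the supports containing `p` of the vectors of `L`, in the form in which
minimality is used: `S` contains no smaller such support. -/
def IsMinimalSupportAt (L : Submodule (ZMod 2) (P → V)) (S : Set P) (p : P) : Prop :=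
  ∀ v ∈ part L S, v p ≠ 0 → ∀ q ∈ S, v q ≠ 0

theorem exists_isMinimalSupportAt [Finite P] (h : ∃ v ∈ L, v p ≠ 0) :
    ∃ v₀ ∈ L, v₀ p ≠ 0 ∧ IsMinimalSupportAt L (Function.support v₀) p := by
  obtain ⟨v₀, ⟨hv₀, hp⟩, hmin⟩ := exists_minimalFor_of_wellFoundedLT
    (fun v => v ∈ L ∧ v p ≠ 0) Function.support h
  refine ⟨v₀, hv₀, hp, fun v hv hvp q hq => ?_⟩
  exact hmin ⟨hv.1, hvp⟩ (fun r hr => by_contra fun hr' => hr (hv.2 r hr')) hq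

/-- The evaluation of the vectors of `L_S` at the qubit `q`. -/
def evalPart (L : Submodule (ZMod 2) (P → V)) (S : Set P) (q : P) : part L S →ₗ[ZMod 2] V :=
  LinearMap.proj q ∘ₗ (part L S).subtype

/-- A vector of `L_S` is determined by its value at any single qubit of `S`, and that value is
arbitrary. -/
def HasBijectiveCoordinates (L : Submodule (ZMod 2) (P → V)) (S : Set P) : Prop :=
  ∀ q ∈ S, Function.Bijective (evalPart L S q)

theorem evalPart_surjective {v₀ v₁ : P → V} (h₀ : v₀ ∈ part L S) (h₁ : v₁ ∈ part L S)
    (hp₀ : v₀ p ≠ 0) (hp₁ : v₁ p ≠ 0) (hp : v₀ p ≠ v₁ p) :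
    Function.Surjective (evalPart L S p) := by
  have exhaust {x y : V} (hx : x ≠ 0) (hy : y ≠ 0) (hxy : x ≠ y) (a : V) :
      a = 0 ∨ a = x ∨ a = y ∨ a = x + y := by decide +revert
  intro a
  rcases exhaust hp₀ hp₁ hp a with rfl | rfl | rfl | rfl
  · exact ⟨0, rfl⟩
  · exact ⟨⟨v₀, h₀⟩, rfl⟩
  · exact ⟨⟨v₁, h₁⟩, rfl⟩
  · exact ⟨⟨v₀, h₀⟩ + ⟨v₁, h₁⟩, rfl⟩

/-- By minimality a vector of `L_S` vanishing at some qubit of `S` vanishes at `p`; as `L_S`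
already has the full dimension `2` at `p`, all these evaluations have the same kernel. -/
theorem IsMinimalSupportAt.hasBijectiveCoordinates [Finite P] (hmin : IsMinimalSupportAt L S p)
    (hsurj : Function.Surjective (evalPart L S p)) : HasBijectiveCoordinates L S := by
  have key : ∀ q ∈ S, Function.Surjective (evalPart L S q) ∧
      LinearMap.ker (evalPart L S q) = LinearMap.ker (evalPart L S p) := fun q hq =>
    surjective_and_ker_eq_of_ker_le hsurj fun v hvq =>
      by_contra fun hvp => hmin v.1 v.2 hvp q hq hvq
  refine fun q hq => ⟨LinearMap.ker_eq_bot.1 <| (Submodule.eq_bot_iff _).2 fun v hv => ?_,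
    (key q hq).1⟩
  rw [(key q hq).2] at hv
  refine Subtype.ext (funext fun r => ?_)
  by_cases hr : r ∈ S
  · rw [← (key r hr).2] at hv
    exact hv
  · exact v.2.2 r hr

namespace HasBijectiveCoordinates

variable (hS : HasBijectiveCoordinates L S)
include hS

theorem eq_of_apply_eq {v w : P → V} (hv : v ∈ part L S) (hw : w ∈ part L S) (hq : q ∈ S)
    (h : v q = w q) : v = w :=
  congrArg Subtype.val ((hS q hq).1 (a₁ := ⟨v, hv⟩) (a₂ := ⟨w, hw⟩) h)

theorem exists_apply_eq (hq : q ∈ S) (a : V) : ∃ v ∈ part L S, v q = a :=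
  let ⟨v, hv⟩ := (hS q hq).2 a
  ⟨v.1, v.2, hv⟩

theorem part_eq_bot (hTS : T ⊂ S) : part L T = ⊥ := by
  obtain ⟨q, hqS, hqT⟩ := Set.exists_of_ssubset hTS
  exact (Submodule.eq_bot_iff _).2 fun v hv =>
    hS.eq_of_apply_eq (part_mono hTS.subset hv) (zero_mem _) hqS (hv.2 q hqT)

theorem isIndecomposable (hne : S.Nonempty) : IsIndecomposable L S := by
  intro T hTS hT hTne heq
  rw [hS.part_eq_bot (hTS.ssubset_of_ne hTne),
    hS.part_eq_bot (Set.sdiff_ssubset_left_iff.2 (hT.mono fun q hq => ⟨hTS hq, hq⟩)),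
    sup_bot_eq] at heq
  obtain ⟨q, hq⟩ := hne
  obtain ⟨v, hv, hvq⟩ := hS.exists_apply_eq hq (1, 0)
  rw [heq, Submodule.mem_bot] at hv
  exact zero_ne_one (congrArg Prod.fst (hv ▸ hvq))

theorem finrank_part (hne : S.Nonempty) : Module.finrank (ZMod 2) (part L S) = 2 := by
  obtain ⟨q, hq⟩ := hne
  rw [(LinearEquiv.ofBijective _ (hS q hq)).finrank_eq, Module.finrank_prod, Module.finrank_self]

variable [Fintype P] (hL : IsIsotropic L)
include hL

/-- The vectors of `L_S` take all values at `q`, and the symplectic form of `V` is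
non-degenerate. -/
theorem apply_eq_zero_of_isIsotropic (hq : q ∈ S) {d : P → V} (hd : d ∈ L)
    (hdS : ∀ r ∈ S, r ≠ q → d r = 0) : d q = 0 := by
  have nondegenerate : ∀ x : V, (∀ y : V, x.1 * y.2 - x.2 * y.1 = 0) → x = 0 := by decide
  refine nondegenerate _ fun a => ?_
  obtain ⟨v, hv, rfl⟩ := hS.exists_apply_eq hq a
  have horth := hL d hd v hv.1
  rwa [omega, Finset.sum_eq_single q _ (by simp)] at horth
  intro r _ hr
  by_cases hrS : r ∈ S
  · simp [hdS r hrS hr]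
  · simp [hv.2 r hrS]

theorem nontrivial (hne : S.Nonempty) : S.Nontrivial := by
  by_contra hsub
  rw [Set.not_nontrivial_iff] at hsub
  obtain ⟨q, hq⟩ := hne
  obtain ⟨v, hv, hvq⟩ := hS.exists_apply_eq hq (1, 0)
  have := hS.apply_eq_zero_of_isIsotropic hL hq hv.1 fun r hr hrq => absurd (hsub hr hq) hrq
  simp [hvq] at this

theorem splitsOff_pair {r : P} (hpair : S = {q, r}) : SplitsOff L S := by
  have hq : q ∈ S := by simp [hpair]
  have hr : r ∈ S := by simp [hpair]
  refine splitsOff_iff_le.2 fun v hv => ?_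
  obtain ⟨x, hx, hxq⟩ := hS.exists_apply_eq hq (v q)
  have hd : v - x ∈ L := sub_mem hv hx.1
  have hdq : (v - x) q = 0 := sub_eq_zero.2 hxq.symm
  have hdr : (v - x) r = 0 := hS.apply_eq_zero_of_isIsotropic hL hr hd fun s hs hsr => by
    rw [hpair] at hs
    rwa [hs.resolve_right hsr]
  rw [← add_sub_cancel x v]
  refine Submodule.add_mem_sup hx (mem_part_iff.2 ⟨hd, fun s hs => ?_⟩)
  rw [Set.notMem_compl_iff, hpair] at hs
  rcases hs with rfl | rfl <;> assumption

theorem hasBellFactor (hcard : S.ncard = 2) : HasBellFactor L := by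
  obtain ⟨q, r, -, hpair⟩ := Set.ncard_eq_two.1 hcard
  have hne : S.Nonempty := ⟨q, by simp [hpair]⟩
  refine ⟨S, hcard, hS.splitsOff_pair hL hpair, ⟨?_, ?_⟩, hS.isIndecomposable hne⟩
  · exact fun v hv w hw => hL v hv.1 w hw.1
  · rw [hS.finrank_part hne, hcard]

theorem exists_pair_ne (hBell : ¬ HasBellFactor L) (hp : p ∈ S) :
    ∃ q ∈ S, ∃ r ∈ S, q ≠ p ∧ r ≠ p ∧ q ≠ r := by
  obtain ⟨q, hq, hqp⟩ := (hS.nontrivial hL ⟨p, hp⟩).exists_ne p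
  by_contra! h
  refine hBell (hS.hasBellFactor hL (Set.ncard_eq_two.2 ⟨p, q, hqp.symm, ?_⟩))
  refine Set.Subset.antisymm (fun r hr => ?_) (Set.pair_subset hp hq)
  by_cases hrp : r = p
  · exact Or.inl hrp
  · exact Or.inr (h q hq r hr hqp hrp).symm

end HasBijectiveCoordinates

end Support

/-! ### The local constraints on automorphisms -/

section Local

variable {P : Type*} {p : P} {b : P → U2} {x y w v : P → V} {L : Submodule (ZMod 2) (P → V)}
  {S : Set P}

theorem Occurs.mem_part (h : Occurs b w v) (hv : v ∈ L) (hw : ∀ s, s ∉ S → w s = 0) :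
    v ∈ part L S :=
  mem_part_iff.2 ⟨hv, fun s hs => (eq_zero_iff_of_conjCoeff_ne_zero (h s)).1 (hw s hs)⟩

variable [DecidableEq P]

theorem occurs_mulSingle_iff {c : U2} : Occurs (Pi.mulSingle p c) w v ↔
    conjCoeff c (w p) (v p) ≠ 0 ∧ ∀ q, q ≠ p → w q = v q := by
  refine ⟨fun h => ⟨by simpa using h p, fun q hq => ?_⟩, fun ⟨hp, h⟩ q => ?_⟩
  · simpa [Pi.mulSingle_eq_of_ne hq, conjCoeff_one_ne_zero_iff] using h q
  · obtain rfl | hq := eq_or_ne q p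
    · simpa using hp
    · simpa [Pi.mulSingle_eq_of_ne hq, conjCoeff_one_ne_zero_iff] using h q hq

theorem occurs_update_one_iff : Occurs (Function.update b p 1) w v ↔
    w p = v p ∧ ∀ q, q ≠ p → conjCoeff (b q) (w q) (v q) ≠ 0 := by
  refine ⟨fun h => ⟨by simpa [conjCoeff_one_ne_zero_iff] using h p, fun q hq => ?_⟩,
    fun ⟨hp, h⟩ q => ?_⟩
  · simpa [hq] using h q
  · obtain rfl | hq := eq_or_ne q p
    · simpa [conjCoeff_one_ne_zero_iff] using hp
    · simpa [hq] using h q hq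

variable [Fintype P] {σ : PauliSection L} {u : P → U2}

/-- Conjugating the code projection by `u` at `p` only has the same effect as conjugating it by
`u⁻¹` away from `p`. -/
theorem PreservesCode.pauliCoeff_mulSingle [Fintype L] (hu : PreservesCode σ u) (p : P)
    (w : P → V) : pauliCoeff σ (Pi.mulSingle p (u p)) w =
      pauliCoeff σ (Function.update u⁻¹ p 1) w := by
  have hmul : Function.update u⁻¹ p 1 * u = Pi.mulSingle p (u p) := by
    funext q
    obtain rfl | hq := eq_or_ne q p
    · simp
    · simp [hq]
  rw [← hmul, hu.pauliCoeff_mul]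

theorem PreservesCode.exists_occurs_update (hu : PreservesCode σ u) {a : V} (ha : a ≠ 0)
    (hx : x ∈ L) (hax : conjCoeff (u p) a (x p) ≠ 0)
    (huniq : ∀ v ∈ L, v p ≠ 0 → (∀ q, q ≠ p → x q = v q) → v = x) :
    ∃ y ∈ L, Occurs (Function.update u⁻¹ p 1) (Function.update x p a) y := by
  have := Fintype.ofFinite L
  refine exists_occurs_of_pauliCoeff_eq (hu.pauliCoeff_mulSingle p _) hx
    (occurs_mulSingle_iff.2 ⟨by simpa using hax, fun q hq => by simp [hq]⟩) fun v hv hocc => ?_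
  obtain ⟨hp, hoff⟩ := occurs_mulSingle_iff.1 hocc
  rw [Function.update_self] at hp
  refine huniq v hv ((eq_zero_iff_of_conjCoeff_ne_zero hp).not.1 ha) fun q hq => ?_
  rw [← hoff q hq, Function.update_of_ne hq]

theorem PreservesCode.mem_axisStabilizer (hu : PreservesCode σ u) {g : SO3}
    (hg : Represents (u p) g) {a : Fin 3} (hx : x ∈ part L S) (hxp : x p = axisVec a)
    (hconst : ∀ v ∈ part L S, v p ≠ 0 → v p = axisVec a) : g ∈ axisStabilizer a := by
  have hpS : p ∈ S := by_contra fun h => axisVec_ne_zero a (hxp.symm.trans (hx.2 p h))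
  refine mem_axisStabilizer_of_col fun i hi => by_contra fun hne => hi ?_
  obtain ⟨y, hy, hocc⟩ := hu.exists_occurs_update (axisVec_ne_zero i) hx.1
    (by rwa [hxp, hg.conjCoeff_axisVec_ne_zero_iff]) fun v hv hvp hoff => by
      have hvS : v ∈ part L S := mem_part_iff.2 ⟨hv, fun s hs => by
        rw [← hoff s (ne_of_mem_of_not_mem hpS hs).symm, hx.2 s hs]⟩
      funext q
      obtain rfl | hq := eq_or_ne q p
      · rw [hconst v hvS hvp, hxp]
      · exact (hoff q hq).symm
  have hyS : y ∈ part L S := hocc.mem_part hy fun s hs => by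
    rw [Function.update_of_ne (ne_of_mem_of_not_mem hpS hs).symm, hx.2 s hs]
  have hyp : axisVec i = y p := by simpa using (occurs_update_one_iff.1 hocc).1
  exact axisVec_injective (hyp.trans (hconst y hyS (hyp ▸ axisVec_ne_zero i)))

namespace HasBijectiveCoordinates

variable (hS : HasBijectiveCoordinates L S) (hu : PreservesCode σ u)
  {q : P} (hp : p ∈ S) (hq : q ∈ S) (hqp : q ≠ p)
include hS hu hp hq hqp

theorem conjCoeff_inv_ne_zero (hx : x ∈ part L S) (hy : y ∈ part L S)
    (hxy : conjCoeff (u p) (y p) (x p) ≠ 0) (hyp : y p ≠ 0) {s : P} (hs : s ≠ p) :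
    conjCoeff (u s)⁻¹ (x s) (y s) ≠ 0 := by
  have hne {t : P} (ht : t ∉ S) : t ≠ p := (ne_of_mem_of_not_mem hp ht).symm
  obtain ⟨z, hz, hocc⟩ := hu.exists_occurs_update hyp hx.1 hxy fun v hv _ hoff => by
    have hvS : v ∈ part L S := mem_part_iff.2 ⟨hv, fun t ht => by
      rw [← hoff t (hne ht), hx.2 t ht]⟩
    exact hS.eq_of_apply_eq hvS hx hq (hoff q hqp).symm
  have hzS : z ∈ part L S := hocc.mem_part hz fun t ht => by
    rw [Function.update_of_ne (hne ht), hx.2 t ht]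
  obtain ⟨hzp, hoff⟩ := occurs_update_one_iff.1 hocc
  have hzy : z = y := hS.eq_of_apply_eq hzS hy hp (by rw [← hzp, Function.update_self])
  simpa [hzy, hs] using hoff s hs

/-- The vector that is `x` at `q`, `y` at `p` and `x'` elsewhere is reached from `y` by `u⁻¹` away
from `p`, so up to the value at `p` it also lies in `L`, where it has to coincide both with `x` and
with `x'`. -/
theorem eq_of_conjCoeff_ne_zero {r : P} (hr : r ∈ S) (hrp : r ≠ p) (hqr : q ≠ r) {x' : P → V}
    (hx : x ∈ part L S) (hx' : x' ∈ part L S) (hy : y ∈ part L S) (hyp : y p ≠ 0)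
    (hxy : conjCoeff (u p) (y p) (x p) ≠ 0) (hxy' : conjCoeff (u p) (y p) (x' p) ≠ 0) : x = x' := by
  have := Fintype.ofFinite L
  set w := Function.update (Function.update x' q (x q)) p (y p) with hw
  have hwS : ∀ s, s ∉ S → w s = 0 := fun s hs => by
    rw [hw, Function.update_of_ne (ne_of_mem_of_not_mem hp hs).symm,
      Function.update_of_ne (ne_of_mem_of_not_mem hq hs).symm, hx'.2 s hs]
  have hocc : Occurs (Function.update u⁻¹ p 1) w y := by
    refine occurs_update_one_iff.2 ⟨by simp [hw], fun s hs => ?_⟩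
    obtain rfl | hsq := eq_or_ne s q
    · simpa [hw, hs] using hS.conjCoeff_inv_ne_zero hu hp hq hqp hx hy hxy hyp hs
    · simpa [hw, hs, hsq] using hS.conjCoeff_inv_ne_zero hu hp hq hqp hx' hy hxy' hyp hs
  obtain ⟨z, hz, hzocc⟩ := exists_occurs_of_pauliCoeff_eq (hu.pauliCoeff_mulSingle p w).symm
    hy.1 hocc fun v hv hvocc => hS.eq_of_apply_eq (hvocc.mem_part hv hwS) hy hp <| by
      simp [← (occurs_update_one_iff.1 hvocc).1, hw]
  have hzS := hzocc.mem_part hz hwS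
  have hoff := (occurs_mulSingle_iff.1 hzocc).2
  calc x = z := hS.eq_of_apply_eq hx hzS hq (by simp [← hoff q hqp, hw, hqp])
    _ = x' := hS.eq_of_apply_eq hzS hx' hr (by simp [← hoff r hrp, hw, hrp, hqr.symm])

theorem mem_integralSO {g : SO3} (hg : Represents (u p) g) {r : P} (hr : r ∈ S) (hrp : r ≠ p)
    (hqr : q ≠ r) : g ∈ integralSO (Fin 3) := by
  choose x hx hxp using fun i => hS.exists_apply_eq hp (axisVec i)
  refine mem_integralSO_of_row fun b i j hij => by_contra fun hne => hij ?_
  have hocc (i) (h : g.1 b i ≠ 0) : conjCoeff (u p) (x b p) (x i p) ≠ 0 := by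
    rwa [hxp, hxp, hg.conjCoeff_axisVec_ne_zero_iff]
  have hxij := hS.eq_of_conjCoeff_ne_zero hu hp hq hqp hr hrp hqr (hx i) (hx j) (hx b)
    (hxp b ▸ axisVec_ne_zero b) (hocc i (left_ne_zero_of_mul hne))
    (hocc j (right_ne_zero_of_mul hne))
  exact axisVec_injective (by rw [← hxp i, ← hxp j, hxij])

end HasBijectiveCoordinates

variable (hL : IsIsotropic L) (hzero : ¬ HasZeroFactor L) (hBell : ¬ HasBellFactor L)
  (σ : PauliSection L)
include hL hzero hBell

/-- The two cases are those of a minimal support `S` containing `p` for which `L_S` takes one or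
several non-zero values at `p`. -/
theorem autGroup_apply_mem (p : P) : (∃ a, ∀ g ∈ autGroup σ, g p ∈ axisStabilizer a) ∨
    ∀ g ∈ autGroup σ, g p ∈ integralSO (Fin 3) := by
  obtain ⟨v₀, hv₀, hp₀, hmin⟩ := exists_isMinimalSupportAt (exists_apply_ne_zero hzero p)
  set S := Function.support v₀
  have h₀ : v₀ ∈ part L S := mem_part_iff.2 ⟨hv₀, fun q hq => Function.notMem_support.1 hq⟩
  by_cases hconst : ∀ v ∈ part L S, v p ≠ 0 → v p = v₀ p
  · left
    obtain ⟨a, ha⟩ := exists_axisVec hp₀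
    rw [← ha] at hconst
    refine ⟨a, fun g hg => ?_⟩
    obtain ⟨u, hrep, hu⟩ := mem_autGroup_iff.1 hg
    exact hu.mem_axisStabilizer (hrep p) h₀ ha.symm hconst
  · right
    push Not at hconst
    obtain ⟨v₁, h₁, hp₁, hne⟩ := hconst
    have hbij := hmin.hasBijectiveCoordinates (evalPart_surjective h₀ h₁ hp₀ hp₁ hne.symm)
    obtain ⟨q, hq, r, hr, hqp, hrp, hqr⟩ := hbij.exists_pair_ne hL hBell (p := p) hp₀
    intro g hg
    obtain ⟨u, hrep, hu⟩ := mem_autGroup_iff.1 hg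
    exact hbij.mem_integralSO hu hp₀ hq hqp (hrep p) hr hrp hqr

theorem exists_autGroup_le_pi : ∃ G : P → Subgroup SO3,
    (∀ p, G p = octahedral ∨ ∃ a, G p = dihedral a) ∧ autGroup σ ≤ Subgroup.pi Set.univ G := by
  have (p : P) : ∃ H : Subgroup SO3, (H = octahedral ∨ ∃ a, H = dihedral a) ∧
      ∀ g ∈ autGroup σ, g p ∈ H := by
    rcases autGroup_apply_mem hL hzero hBell σ p with ⟨a, ha⟩ | h
    · exact ⟨dihedral a, Or.inr ⟨a, rfl⟩, dihedral_eq_axisStabilizer a ▸ ha⟩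
    · exact ⟨octahedral, Or.inl rfl, octahedral_eq_integralSO ▸ h⟩
  choose G hG hmem using this
  exact ⟨G, hG, fun g hg p _ => hmem p g hg⟩

end Local

/-! ### Compactness -/

section Compact

variable {n 𝕜 : Type*} [Fintype n] [DecidableEq n] [RCLike 𝕜]

theorem isCompact_unitaryGroup : IsCompact (Matrix.unitaryGroup n 𝕜 : Set (Matrix n n 𝕜)) := by
  have hbounded : IsCompact {A : Matrix n n 𝕜 | ∀ i ∈ Set.univ, ∀ j ∈ Set.univ,
      A i j ∈ Metric.closedBall 0 1} :=
    isCompact_univ_pi fun _ => isCompact_univ_pi fun _ => isCompact_closedBall 0 1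
  refine hbounded.of_isClosed_subset isClosed_unitary fun A hA i _ j _ => ?_
  exact mem_closedBall_zero_iff.2 (entry_norm_bound_of_unitary hA i j)

theorem isClosed_specialUnitaryGroup :
    IsClosed (Matrix.specialUnitaryGroup n 𝕜 : Set (Matrix n n 𝕜)) :=
  isClosed_unitary.inter <| isClosed_eq (Continuous.matrix_det continuous_id) continuous_const

instance : CompactSpace (Matrix.unitaryGroup n 𝕜) :=
  isCompact_iff_compactSpace.1 isCompact_unitaryGroup

instance : CompactSpace (Matrix.specialUnitaryGroup n 𝕜) :=
  isCompact_iff_compactSpace.1 <| isCompact_unitaryGroup.of_isClosed_subset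
    isClosed_specialUnitaryGroup Set.inter_subset_left

instance : IsTopologicalGroup (Matrix.specialUnitaryGroup n 𝕜) where
  continuous_inv := (continuous_star.comp continuous_subtype_val).subtype_mk _

end Compact

section ClosedAutomorphismGroup

theorem isClosed_setOf_represents : IsClosed {x : U2 × SO3 | Represents x.1 x.2} := by
  have hu : Continuous fun x : U2 × SO3 => x.1.1 := continuous_subtype_val.comp continuous_fst
  have hg : Continuous fun x : U2 × SO3 => x.2.1 := continuous_subtype_val.comp continuous_snd
  simp only [Represents, Set.ofPred_forall]
  refine isClosed_iInter fun j => isClosed_eq ?_ ?_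
  · exact (hu.mul continuous_const).mul hu.matrix_conjTranspose
  · exact continuous_finsetSum _ fun i _ =>
      (Complex.continuous_ofReal.comp (hg.matrix_elem i j)).smul continuous_const

variable {P : Type*} [Fintype P] [DecidableEq P] {L : Submodule (ZMod 2) (P → V)}

theorem continuous_localUnitary : Continuous (localUnitary (P := P)) := by
  refine Continuous.subtype_mk (continuous_matrix fun i j => ?_) _
  refine continuous_finsetProd _ fun p _ => ?_
  exact (continuous_subtype_val.comp (continuous_apply p)).matrix_elem (i p) (j p)

theorem isClosed_setOf_preservesCode (σ : PauliSection L) : IsClosed {u | PreservesCode σ u} := by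
  simp only [PreservesCode, Set.ofPred_forall]
  refine isClosed_biInter fun ψ _ => (code σ).closed_of_finiteDimensional.preimage ?_
  exact (continuous_subtype_val.comp continuous_localUnitary).matrix_mulVec continuous_const

theorem isClosed_autGroup (σ : PauliSection L) : IsClosed (autGroup σ : Set (P → SO3)) := by
  have himage : (autGroup σ : Set (P → SO3)) = Prod.snd ''
      {x : (P → U2) × (P → SO3) | (∀ p, Represents (x.1 p) (x.2 p)) ∧ PreservesCode σ x.1} :=
    Set.ext fun g => ⟨fun ⟨u, h⟩ => ⟨(u, g), h, rfl⟩, fun ⟨⟨u, _⟩, h, hg⟩ => ⟨u, hg ▸ h⟩⟩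
  rw [himage]
  refine (IsClosed.isCompact ?_).image continuous_snd |>.isClosed
  rw [Set.ofPred_and, Set.ofPred_forall]
  refine (isClosed_iInter fun p => ?_).inter
    ((isClosed_setOf_preservesCode σ).preimage continuous_fst)
  have hp : Continuous fun x : (P → U2) × (P → SO3) => (x.1 p, x.2 p) :=
    ((continuous_apply p).comp continuous_fst).prodMk ((continuous_apply p).comp continuous_snd)
  exact isClosed_setOf_represents.preimage hp

end ClosedAutomorphismGroup

/-! ### Lie groups with an abelian exponential map -/

/-- Exponential coordinates on a topological group `G`: a chart `log` at the identity whose inverse,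
taken on all of `E` and not only on the target of the chart, is a homomorphism, and on whose values
conjugation is linear. Its translates are the charts of a Lie group structure on `G`. -/
structure LieCoordinates (E G : Type*) [NormedAddCommGroup E] [NormedSpace ℝ E] [Group G]
    [TopologicalSpace G] where
  log : OpenPartialHomeomorph G E
  zero_mem_target : 0 ∈ log.target
  symm_add : ∀ v w, log.symm (v + w) = log.symm v * log.symm w
  exists_conj : ∀ g : G, ∃ T : E →L[ℝ] E, ∀ v, g⁻¹ * log.symm v * g = log.symm (T v)

namespace LieCoordinates

open Topology Filter

variable {E F G X : Type*} [NormedAddCommGroup E] [NormedSpace ℝ E] [NormedAddCommGroup F]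
  [NormedSpace ℝ F] [TopologicalSpace X] [Group G] [TopologicalSpace G]

/-- The same coordinates with values in an isomorphic vector space. -/
def congr (c : LieCoordinates E G) (e : E ≃L[ℝ] F) : LieCoordinates F G where
  log := c.log.transHomeomorph e.toHomeomorph
  zero_mem_target := by
    change e.symm 0 ∈ c.log.target
    rw [map_zero]
    exact c.zero_mem_target
  symm_add v w := by
    change c.log.symm (e.symm (v + w)) = _
    rw [map_add]
    exact c.symm_add _ _
  exists_conj g := by
    obtain ⟨T, hT⟩ := c.exists_conj g
    refine ⟨e ∘L T ∘L e.symm, fun v => ?_⟩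
    change g⁻¹ * c.log.symm (e.symm v) * g = c.log.symm (e.symm (e (T (e.symm v))))
    rw [e.symm_apply_apply]
    exact hT _

variable (c : LieCoordinates E G)

/-- The exponential map, defined on the whole vector space. -/
def exp (v : E) : G := c.log.symm v

theorem exp_add (v w : E) : c.exp (v + w) = c.exp v * c.exp w := c.symm_add v w

theorem exp_zero : c.exp 0 = 1 := by
  have h := c.exp_add 0 0
  rwa [add_zero, left_eq_mul] at h

theorem exp_neg (v : E) : c.exp (-v) = (c.exp v)⁻¹ := by
  rw [eq_inv_iff_mul_eq_one, ← c.exp_add, neg_add_cancel, c.exp_zero]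

theorem exp_sub (v w : E) : c.exp (v - w) = c.exp v * (c.exp w)⁻¹ := by
  rw [sub_eq_add_neg, c.exp_add, c.exp_neg]

theorem one_mem_source : 1 ∈ c.log.source := by
  rw [← c.exp_zero]
  exact c.log.map_target c.zero_mem_target

theorem log_one : c.log 1 = 0 := by
  rw [← c.exp_zero]
  exact c.log.right_inv c.zero_mem_target

theorem log_exp_eventuallyEq {Q : X → E} {x₀ : X} (hQ : ContinuousAt Q x₀) (h₀ : Q x₀ = 0) :
    (fun x => c.log (c.exp (Q x))) =ᶠ[𝓝 x₀] Q :=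
  have htarget : ∀ᶠ x in 𝓝 x₀, Q x ∈ c.log.target :=
    hQ.eventually_mem (c.log.open_target.mem_nhds (h₀ ▸ c.zero_mem_target))
  htarget.mono fun _ => c.log.right_inv

theorem eventuallyEq_add_of_exp_eq {F : E → E} {s : Set E} {x₀ : E} {k : G}
    (hF : ContinuousOn F s) (h : ∀ x ∈ s, c.exp (F x) = k * c.exp x) (hx₀ : x₀ ∈ s) :
    F =ᶠ[𝓝[s] x₀] fun x => F x₀ - x₀ + x := by
  have hk : k = c.exp (F x₀ - x₀) := by rw [c.exp_sub, h x₀ hx₀, mul_inv_cancel_right]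
  have hlim : ContinuousWithinAt (fun x => F x - (F x₀ - x₀ + x)) s x₀ :=
    (hF x₀ hx₀).sub (continuousWithinAt_const.add continuousWithinAt_id)
  have hmem : ∀ᶠ x in 𝓝[s] x₀, F x - (F x₀ - x₀ + x) ∈ c.log.target :=
    hlim (c.log.open_target.mem_nhds (by simpa using c.zero_mem_target))
  filter_upwards [self_mem_nhdsWithin, hmem] with x hx hxt
  have hexp : c.exp (F x - (F x₀ - x₀ + x)) = c.exp 0 := by
    rw [c.exp_sub, c.exp_add, ← hk, h x hx, mul_inv_cancel, c.exp_zero]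
  exact sub_eq_zero.1 (c.log.symm.injOn hxt c.zero_mem_target hexp)

variable [IsTopologicalGroup G]

/-- The translate to `g` of the chart at the identity. -/
def chart (g : G) : OpenPartialHomeomorph G E :=
  (Homeomorph.mulLeft g⁻¹).transOpenPartialHomeomorph c.log

theorem chart_apply (g h : G) : c.chart g h = c.log (g⁻¹ * h) := rfl

theorem chart_symm_apply (g : G) (v : E) : (c.chart g).symm v = g * c.exp v :=
  congrArg (· * c.exp v) (inv_inv g)

theorem mul_exp_chart {g h : G} (hh : h ∈ (c.chart g).source) : g * c.exp (c.chart g h) = h := by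
  rw [← chart_symm_apply, (c.chart g).left_inv hh]

theorem self_mem_chart_source (g : G) : g ∈ (c.chart g).source := by
  change g⁻¹ * g ∈ c.log.source
  rw [inv_mul_cancel]
  exact c.one_mem_source

theorem chart_self (g : G) : c.chart g g = 0 := by
  rw [chart_apply, inv_mul_cancel, log_one]

/-- The atlas of the translates of the chart at the identity. -/
@[reducible]
def chartedSpace : ChartedSpace E G where
  atlas := Set.range c.chart
  chartAt := c.chart
  mem_chart_source := c.self_mem_chart_source
  chart_mem_atlas g := ⟨g, rfl⟩

theorem contDiffOn_chart_transition (g h : G) :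
    ContDiffOn ℝ ∞ ((c.chart g).symm ≫ₕ c.chart h) ((c.chart g).symm ≫ₕ c.chart h).source := by
  intro v hv
  have hexp : ∀ w ∈ ((c.chart g).symm ≫ₕ c.chart h).source,
      c.exp (((c.chart g).symm ≫ₕ c.chart h) w) = h⁻¹ * g * c.exp w := by
    intro w hw
    rw [OpenPartialHomeomorph.trans_source] at hw
    rw [mul_assoc, eq_inv_mul_iff_mul_eq, ← c.chart_symm_apply g]
    exact c.mul_exp_chart hw.2
  have heq := c.eventuallyEq_add_of_exp_eq (OpenPartialHomeomorph.continuousOn _) hexp hv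
  exact (contDiff_const.add contDiff_id).contDiffWithinAt.congr_of_eventuallyEq heq
    (sub_add_cancel _ _).symm

theorem isManifold : letI := c.chartedSpace; IsManifold 𝓘(ℝ, E) ∞ G := by
  let := c.chartedSpace
  refine isManifold_of_contDiffOn _ _ _ ?_
  rintro _ _ ⟨g, rfl⟩ ⟨h, rfl⟩
  simpa only [modelWithCornersSelf_coe, modelWithCornersSelf_coe_symm, Function.id_comp,
    Function.comp_id, Set.preimage_id, Set.range_id, Set.inter_univ]
    using c.contDiffOn_chart_transition g h

theorem chart_mul_chart_symm {g h : G} {T : E →L[ℝ] E} (hT : ∀ v, h⁻¹ * c.exp v * h = c.exp (T v))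
    (v w : E) : c.chart (g * h) ((c.chart g).symm v * (c.chart h).symm w) =
      c.log (c.exp (T v + w)) := by
  rw [chart_apply, chart_symm_apply, chart_symm_apply, c.exp_add, ← hT]
  group

theorem chart_inv_chart_symm {g : G} {T : E →L[ℝ] E} (hT : ∀ v, g⁻¹⁻¹ * c.exp v * g⁻¹ = c.exp (T v))
    (v : E) : c.chart g⁻¹ ((c.chart g).symm v)⁻¹ = c.log (c.exp (-T v)) := by
  rw [chart_apply, chart_symm_apply, c.exp_neg, ← hT]
  group

theorem contMDiff_mul :
    letI := c.chartedSpace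
    ContMDiff (𝓘(ℝ, E).prod 𝓘(ℝ, E)) 𝓘(ℝ, E) ∞ fun x : G × G => x.1 * x.2 := by
  let := c.chartedSpace
  rintro ⟨g, h⟩
  obtain ⟨T, hT⟩ := c.exists_conj h
  have h₀ : extChartAt (𝓘(ℝ, E).prod 𝓘(ℝ, E)) (g, h) (g, h) = 0 :=
    Prod.ext (c.chart_self g) (c.chart_self h)
  have hsmooth : ContDiffAt ℝ ∞ (fun x : E × E => T x.1 + x.2) 0 :=
    ((T.contDiff.comp contDiff_fst).add contDiff_snd).contDiffAt
  rw [contMDiffAt_iff, h₀]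
  refine ⟨continuous_mul.continuousAt, ContDiffAt.contDiffWithinAt ?_⟩
  refine ContDiffAt.congr_of_eventuallyEq hsmooth <|
    EventuallyEq.trans (Eventually.of_forall fun x => c.chart_mul_chart_symm hT x.1 x.2) ?_
  exact c.log_exp_eventuallyEq hsmooth.continuousAt (by simp)

theorem contMDiff_inv :
    letI := c.chartedSpace
    ContMDiff 𝓘(ℝ, E) 𝓘(ℝ, E) ∞ fun x : G => x⁻¹ := by
  let := c.chartedSpace
  intro g
  obtain ⟨T, hT⟩ := c.exists_conj g⁻¹
  have h₀ : extChartAt 𝓘(ℝ, E) g g = 0 := c.chart_self g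
  have hsmooth : ContDiffAt ℝ ∞ (fun v : E => -T v) 0 := T.contDiff.neg.contDiffAt
  rw [contMDiffAt_iff, h₀]
  refine ⟨continuous_inv.continuousAt, ContDiffAt.contDiffWithinAt ?_⟩
  refine ContDiffAt.congr_of_eventuallyEq hsmooth <|
    EventuallyEq.trans (Eventually.of_forall fun v => c.chart_inv_chart_symm hT v) ?_
  exact c.log_exp_eventuallyEq hsmooth.continuousAt (by simp)

theorem lieGroup : letI := c.chartedSpace; LieGroup 𝓘(ℝ, E) ∞ G := by
  let := c.chartedSpace
  have := c.isManifold
  exact { contMDiff_mul := c.contMDiff_mul, contMDiff_inv := c.contMDiff_inv }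

theorem isCompactLieGroup (c : LieCoordinates E G) [FiniteDimensional ℝ E] [CompactSpace G]
    [T2Space G] : IsCompactLieGroup G :=
  ⟨inferInstance, inferInstance, Module.finrank ℝ E,
    (c.congr (toEuclidean (E := E))).chartedSpace, (c.congr toEuclidean).lieGroup⟩

end LieCoordinates

/-! ### Closed subgroups of Euclidean spaces -/

section LinearPart

variable {E : Type*} [AddCommGroup E] [Module ℝ E]

/-- The largest linear subspace contained in an additive subgroup of a real vector space. -/
def linearPart (H : AddSubgroup E) : Submodule ℝ E where
  carrier := {w | ∀ t : ℝ, t • w ∈ H}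
  add_mem' {v w} hv hw t := smul_add t v w ▸ H.add_mem (hv t) (hw t)
  zero_mem' t := (smul_zero (A := E) t).symm ▸ H.zero_mem
  smul_mem' s w hw t := smul_smul t s w ▸ hw (t * s)

theorem mem_of_mem_linearPart {H : AddSubgroup E} {w : E} (hw : w ∈ linearPart H) : w ∈ H :=
  one_smul ℝ w ▸ hw 1

end LinearPart

section ClosedAddSubgroup

open Topology Filter

variable {E : Type*} [NormedAddCommGroup E]

theorem mem_linearPart_of_tendsto [NormedSpace ℝ E] {H : AddSubgroup E}
    (hH : IsClosed (H : Set E)) {b : ℕ → E} {u : E} (hbH : ∀ n, b n ∈ H)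
    (hb : Tendsto b atTop (𝓝 0)) (hu : Tendsto (fun n => ‖b n‖⁻¹ • b n) atTop (𝓝 u)) :
    u ∈ linearPart H := by
  intro t
  -- `t • u` is approximated by the integral multiples `⌊t / ‖b n‖⌋ • b n`.
  have hfract : Tendsto (fun n => Int.fract (t * ‖b n‖⁻¹) • b n) atTop (𝓝 0) := by
    refine squeeze_zero_norm (fun n => ?_) (tendsto_norm_zero.comp hb)
    rw [norm_smul, Real.norm_of_nonneg (Int.fract_nonneg _)]
    exact mul_le_of_le_one_left (norm_nonneg _) (Int.fract_lt_one _).le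
  have hlim := (hu.const_smul t).sub hfract
  rw [sub_zero] at hlim
  refine hH.mem_of_tendsto hlim (Eventually.of_forall fun n => ?_)
  rw [smul_smul, ← sub_smul, Int.self_sub_fract, Int.cast_smul_eq_zsmul]
  exact H.zsmul_mem (hbH n) _

variable [InnerProductSpace ℝ E] [FiniteDimensional ℝ E] {H : AddSubgroup E}

theorem exists_eq_zero_of_mem_orthogonal_linearPart (hH : IsClosed (H : Set E)) :
    ∃ r > 0, ∀ b ∈ H, b ∈ (linearPart H)ᗮ → ‖b‖ < r → b = 0 := by
  by_contra! hcon
  choose b hbH hbW hlt hb₀ using fun n : ℕ => hcon (1 / ((n : ℝ) + 1)) Nat.one_div_pos_of_nat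
  have hb : Tendsto b atTop (𝓝 0) :=
    squeeze_zero_norm (fun n => (hlt n).le) tendsto_one_div_add_atTop_nhds_zero_nat
  obtain ⟨u, hu, φ, hφ, hlim⟩ := (isCompact_sphere (0 : E) 1).tendsto_subseq
    (x := fun n => ‖b n‖⁻¹ • b n) fun n => by
      rw [mem_sphere_zero_iff_norm, norm_smul, norm_inv, norm_norm,
        inv_mul_cancel₀ (norm_ne_zero_iff.2 (hb₀ n))]
  have huW : u ∈ linearPart H :=
    mem_linearPart_of_tendsto hH (fun n => hbH (φ n)) (hb.comp hφ.tendsto_atTop) hlim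
  have huW' : u ∈ (linearPart H)ᗮ := (Submodule.isClosed_orthogonal _).mem_of_tendsto hlim <|
    Eventually.of_forall fun n => Submodule.smul_mem _ _ (hbW _)
  have hu₀ : u = 0 := Submodule.disjoint_def.1 (Submodule.orthogonal_disjoint _) u huW huW'
  rw [hu₀, mem_sphere_zero_iff_norm, norm_zero] at hu
  exact zero_ne_one hu

theorem exists_mem_linearPart_of_norm_lt (hH : IsClosed (H : Set E)) :
    ∃ r > 0, ∀ h ∈ H, ‖h‖ < r → h ∈ linearPart H := by
  obtain ⟨r, hr, hr₀⟩ := exists_eq_zero_of_mem_orthogonal_linearPart hH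
  refine ⟨r, hr, fun h hh hlt => ?_⟩
  set W := linearPart H
  have hproj : W.starProjection h ∈ W := W.starProjection_apply_mem h
  have hzero : h - W.starProjection h = 0 := by
    refine hr₀ _ (H.sub_mem hh (mem_of_mem_linearPart hproj))
      (W.sub_starProjection_mem_orthogonal h) (lt_of_le_of_lt ?_ hlt)
    rw [← Submodule.starProjection_orthogonal_val]
    exact Wᗮ.norm_starProjection_apply_le h
  rwa [← sub_eq_zero.1 hzero] at hproj

end ClosedAddSubgroup

/-! ### Closed subgroups of products of octahedral and dihedral groups -/

section Torus

theorem continuous_entry (i j : Fin 3) : Continuous fun g : SO3 => g.1 i j :=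
  continuous_subtype_val.matrix_elem i j

theorem continuous_axisRot (a : Fin 3) : Continuous (axisRot a) := by
  refine Continuous.subtype_mk (continuous_matrix fun i j => ?_) _
  fin_cases a <;> fin_cases i <;> fin_cases j <;> first
    | exact continuous_const
    | exact Real.continuous_cos
    | exact Real.continuous_sin
    | exact Real.continuous_sin.neg

theorem axisRot_zero (a : Fin 3) : axisRot a 0 = 1 :=
  map_one (axisRotHom a)

theorem axisAngle_axisRot {a : Fin 3} {θ : ℝ} (hθ : θ ∈ Set.Ioc (-Real.pi) Real.pi) :
    axisAngle a (axisRot a θ) = θ := by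
  have hz : (⟨Real.cos θ, Real.sin θ⟩ : ℂ) = Complex.cos θ + Complex.sin θ * Complex.I := by
    apply Complex.ext <;> simp [Complex.cos_ofReal_re, Complex.sin_ofReal_re]
  rw [axisAngle, axisRot_entry_cos, axisRot_entry_sin, hz, Complex.arg_cos_add_sin_mul_I hθ]

theorem continuousAt_axisAngle {a : Fin 3} {g : SO3} (hg : 0 < g.1 (a + 1) (a + 1)) :
    ContinuousAt (axisAngle a) g := by
  have hz : Continuous fun g : SO3 => (⟨g.1 (a + 1) (a + 1), g.1 (a + 2) (a + 1)⟩ : ℂ) :=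
    Complex.equivRealProdCLM.symm.continuous.comp
      ((continuous_entry _ _).prodMk (continuous_entry _ _))
  exact ContinuousAt.comp (g := Complex.arg) (Complex.continuousAt_arg (Or.inl hg))
    hz.continuousAt

variable {P : Type*} (a : P → Fin 3)

/-- The family of the rotations around the axes `a p` by the angles `w p`. -/
def torusExp (w : EuclideanSpace ℝ P) : P → SO3 := fun p => axisRot (a p) (w p)

/-- The family of the angles of the rotations around the axes `a p`, a local inverse of
`torusExp a`. -/
def torusLog (g : P → SO3) : EuclideanSpace ℝ P := WithLp.toLp 2 fun p => axisAngle (a p) (g p)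

/-- The families of rotations all of whose diagonal entries at `a p` and `a p + 1` are positive; on
it `torusLog a` is continuous. -/
def torusNhd : Set (P → SO3) :=
  {g | ∀ p, 0 < (g p).1 (a p) (a p) ∧ 0 < (g p).1 (a p + 1) (a p + 1)}

theorem torusExp_add (v w : EuclideanSpace ℝ P) :
    torusExp a (v + w) = torusExp a v * torusExp a w :=
  funext fun p => axisRot_add (a p) (v p) (w p)

/-- The group of the families of angles whose rotations belong to `A`. -/
def torusComap (A : Subgroup (P → SO3)) : AddSubgroup (EuclideanSpace ℝ P) :=
  Subgroup.toAddSubgroup' <|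
    A.comap (MonoidHom.mk' (M := Multiplicative (EuclideanSpace ℝ P)) (torusExp a) (torusExp_add a))

theorem mem_torusComap {A : Subgroup (P → SO3)} {w : EuclideanSpace ℝ P} :
    w ∈ torusComap a A ↔ torusExp a w ∈ A := Iff.rfl

theorem continuous_torusExp : Continuous (torusExp a) :=
  continuous_pi fun p => (continuous_axisRot (a p)).comp (by fun_prop)

theorem isClosed_torusComap {A : Subgroup (P → SO3)} (hA : IsClosed (A : Set (P → SO3))) :
    IsClosed (torusComap a A : Set (EuclideanSpace ℝ P)) :=
  hA.preimage (continuous_torusExp a)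

theorem continuousOn_torusLog : ContinuousOn (torusLog a) (torusNhd a) := fun _ hg =>
  ((PiLp.continuous_toLp 2 _).continuousAt.comp <| continuousAt_pi.2 fun p =>
    ContinuousAt.comp (g := axisAngle (a p)) (continuousAt_axisAngle (hg p).2)
      (continuous_apply p).continuousAt).continuousWithinAt

theorem isOpen_torusNhd [Finite P] : IsOpen (torusNhd a) := by
  have hentry : ∀ p i, Continuous fun g : P → SO3 => (g p).1 i i := fun p i =>
    (continuous_entry i i).comp (continuous_apply p)
  rw [torusNhd, Set.ofPred_forall]
  exact isOpen_iInter_of_finite fun p =>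
    (isOpen_lt continuous_const (hentry p _)).inter (isOpen_lt continuous_const (hentry p _))

variable {a}

theorem torusLog_torusExp {w : EuclideanSpace ℝ P} (hw : ∀ p, |w p| < Real.pi / 2) :
    torusLog a (torusExp a w) = w := by
  ext p
  have h := abs_lt.1 (hw p)
  exact axisAngle_axisRot ⟨by linarith [Real.pi_pos], by linarith [Real.pi_pos]⟩

theorem torusExp_mem_torusNhd {w : EuclideanSpace ℝ P} (hw : ∀ p, |w p| < Real.pi / 2) :
    torusExp a w ∈ torusNhd a := fun p => by
  rw [torusExp, axisRot_entry_self, axisRot_entry_cos]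
  exact ⟨one_pos, Real.cos_pos_of_mem_Ioo (abs_lt.1 (hw p))⟩

/-- The diagonal action of a family of rotations on the angles, by the signs with which it acts on
the axes `a p`. -/
def torusAd (a : P → Fin 3) (g : P → SO3) : EuclideanSpace ℝ P →ₗ[ℝ] EuclideanSpace ℝ P where
  toFun w := WithLp.toLp 2 fun p => (g p).1 (a p) (a p) * w p
  map_add' v w := by ext p; exact mul_add _ _ _
  map_smul' t w := by ext p; exact mul_left_comm _ _ _

variable {A : Subgroup (P → SO3)}
  (hA : ∀ p, (∀ g ∈ A, g p ∈ axisStabilizer (a p)) ∨ ∀ g ∈ A, g p ∈ integralSO (Fin 3))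

include hA in
theorem torusExp_torusLog {g : P → SO3} (hg : g ∈ A) (hN : g ∈ torusNhd a) :
    torusExp a (torusLog a g) = g := by
  refine funext fun p => axisRot_axisAngle ?_
  have hpos := (hN p).1
  have hsq : (g p).1 (a p) (a p) ^ 2 = 1 := by
    rcases hA p with h | h
    · exact h g hg
    · exact (entry_of_mem_integralSO (h g hg) _ _).resolve_left hpos.ne'
  exact (pow_eq_one_iff_of_nonneg hpos.le two_ne_zero).1 hsq

theorem apply_eq_zero_of_mem_linearPart {p : P} (hp : ∀ g ∈ A, g p ∈ integralSO (Fin 3))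
    {w : EuclideanSpace ℝ P} (hw : w ∈ linearPart (torusComap a A)) : w p = 0 := by
  by_contra h₀
  -- Otherwise `A` contains a family of rotations whose component at `p` has the angle `π / 3`.
  have hmem : torusExp a ((Real.pi / 3 / w p) • w) ∈ A := hw _
  have hentry : (torusExp a ((Real.pi / 3 / w p) • w) p).1 (a p + 1) (a p + 1) = 1 / 2 := by
    rw [torusExp, axisRot_entry_cos, PiLp.smul_apply, smul_eq_mul, div_mul_cancel₀ _ h₀,
      Real.cos_pi_div_three]
  have hint := entry_of_mem_integralSO (hp _ hmem) (a p + 1) (a p + 1)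
  rw [hentry] at hint
  norm_num at hint

include hA in
theorem conj_torusExp {g : P → SO3} (hg : g ∈ A) {w : EuclideanSpace ℝ P}
    (hw : w ∈ linearPart (torusComap a A)) :
    g * torusExp a w * g⁻¹ = torusExp a (torusAd a g w) := by
  funext p
  change g p * axisRot (a p) (w p) * (g p)⁻¹ = axisRot (a p) ((g p).1 (a p) (a p) * w p)
  rcases hA p with h | h
  · rw [mul_axisRot (h g hg), mul_inv_cancel_right]
  · rw [apply_eq_zero_of_mem_linearPart h hw, mul_zero, axisRot_zero, mul_one, mul_inv_cancel]

include hA in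
theorem torusAd_mem_linearPart {g : P → SO3} (hg : g ∈ A) {w : EuclideanSpace ℝ P}
    (hw : w ∈ linearPart (torusComap a A)) : torusAd a g w ∈ linearPart (torusComap a A) := by
  intro t
  rw [← map_smul, mem_torusComap, ← conj_torusExp hA hg (Submodule.smul_mem _ t hw)]
  exact mul_mem (mul_mem hg (hw t)) (inv_mem hg)

variable [Fintype P]

theorem abs_apply_lt_of_norm_lt {r : ℝ} {w : EuclideanSpace ℝ P} (hw : ‖w‖ < r) (p : P) :
    |w p| < r :=
  (PiLp.norm_apply_le w p).trans_lt hw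

variable {r : ℝ} (hr : r ≤ Real.pi / 2)
  (hlin : ∀ w ∈ torusComap a A, ‖w‖ < r → w ∈ linearPart (torusComap a A))

include hA hlin in
theorem torusLog_mem_linearPart {g : P → SO3} (hg : g ∈ A) (hN : g ∈ torusNhd a)
    (hlt : ‖torusLog a g‖ < r) : torusLog a g ∈ linearPart (torusComap a A) :=
  hlin _ (by rwa [mem_torusComap, torusExp_torusLog hA hg hN]) hlt

include hA hlin in
theorem coe_orthogonalProjectionOnto_torusLog {g : P → SO3} (hg : g ∈ A) (hN : g ∈ torusNhd a)
    (hlt : ‖torusLog a g‖ < r) :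
    ((linearPart (torusComap a A)).orthogonalProjectionOnto (torusLog a g) :
      EuclideanSpace ℝ P) = torusLog a g :=
  Submodule.starProjection_eq_self_iff.2 (torusLog_mem_linearPart hA hlin hg hN hlt)

/-- The chart of `A` at the identity given by the angles around the axes `a p`. Near the identity
the angles of an element of `A` lie in the linear part, so that projecting them changes nothing. -/
def torusChart : OpenPartialHomeomorph A (linearPart (torusComap a A)) where
  toFun g := (linearPart (torusComap a A)).orthogonalProjectionOnto (torusLog a g)
  invFun w := ⟨torusExp a w, mem_of_mem_linearPart w.2⟩
  source := Subtype.val ⁻¹' (torusNhd a ∩ torusLog a ⁻¹' Metric.ball 0 r)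
  target := Metric.ball 0 r
  map_source' := fun ⟨g, hg⟩ ⟨hN, hlt⟩ => by
    have hlt : ‖torusLog a g‖ < r := mem_ball_zero_iff.1 hlt
    rwa [mem_ball_zero_iff, Submodule.coe_norm,
      coe_orthogonalProjectionOnto_torusLog hA hlin hg hN hlt]
  map_target' w hw := by
    have hlt := mem_ball_zero_iff.1 hw
    have hpi := fun p => (abs_apply_lt_of_norm_lt (w := w.1) hlt p).trans_le hr
    refine ⟨torusExp_mem_torusNhd hpi, ?_⟩
    rwa [Set.mem_preimage, torusLog_torusExp hpi, mem_ball_zero_iff]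
  left_inv' := fun ⟨g, hg⟩ ⟨hN, hlt⟩ => Subtype.ext <| by
    change torusExp a _ = g
    rw [coe_orthogonalProjectionOnto_torusLog hA hlin hg hN (mem_ball_zero_iff.1 hlt),
      torusExp_torusLog hA hg hN]
  right_inv' w hw := by
    have hpi := fun p =>
      (abs_apply_lt_of_norm_lt (w := w.1) (mem_ball_zero_iff.1 hw) p).trans_le hr
    rw [torusLog_torusExp hpi, Submodule.orthogonalProjectionOnto_mem_subspace_eq_self]
  open_source := ((continuousOn_torusLog a).isOpen_inter_preimage (isOpen_torusNhd a)
    Metric.isOpen_ball).preimage continuous_subtype_val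
  open_target := Metric.isOpen_ball
  continuousOn_toFun := (ContinuousLinearMap.continuous _).comp_continuousOn <|
    (continuousOn_torusLog a).comp continuous_subtype_val.continuousOn fun _ hg => hg.1
  continuousOn_invFun :=
    (((continuous_torusExp a).comp continuous_subtype_val).subtype_mk _).continuousOn

/-- The exponential coordinates on `A` given by the angles around the axes `a p`. -/
def torusLieCoordinates (hr₀ : 0 < r) : LieCoordinates (linearPart (torusComap a A)) A where
  log := torusChart hA hr hlin
  zero_mem_target := Metric.mem_ball_self hr₀
  symm_add v w := Subtype.ext (torusExp_add a v w)
  exists_conj g := by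
    refine ⟨LinearMap.toContinuousLinearMap <| (torusAd a (g⁻¹).1).restrict fun w hw =>
      torusAd_mem_linearPart hA (g⁻¹).2 hw, fun v => Subtype.ext ?_⟩
    have hconj := conj_torusExp hA (g⁻¹).2 v.2
    rwa [Subgroup.coe_inv, inv_inv] at hconj

include hA in
omit [Fintype P] in
theorem isCompactLieGroup_of_mem_axisStabilizer_or_mem_integralSO [Finite P]
    (hcl : IsClosed (A : Set (P → SO3))) : IsCompactLieGroup A := by
  let := Fintype.ofFinite P
  have := isCompact_iff_compactSpace.1 hcl.isCompact
  obtain ⟨r, hr, hlin⟩ := exists_mem_linearPart_of_norm_lt (isClosed_torusComap a hcl)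
  have hlin' : ∀ w ∈ torusComap a A, ‖w‖ < min r (Real.pi / 2) → w ∈ linearPart (torusComap a A) :=
    fun w hw hlt => hlin w hw (hlt.trans_le (min_le_left _ _))
  exact (torusLieCoordinates hA (min_le_right _ _) hlin'
    (lt_min hr Real.pi_div_two_pos)).isCompactLieGroup

end Torus

theorem isCompactLieGroup_of_le_pi {P : Type*} [Finite P] {A : Subgroup (P → SO3)}
    (hcl : IsClosed (A : Set (P → SO3))) {G : P → Subgroup SO3}
    (hG : ∀ p, G p = octahedral ∨ ∃ a, G p = dihedral a) (hA : A ≤ Subgroup.pi Set.univ G) :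
    IsCompactLieGroup A := by
  have hloc : ∀ p, ∃ a, (∀ g ∈ A, g p ∈ axisStabilizer a) ∨
      ∀ g ∈ A, g p ∈ integralSO (Fin 3) := fun p => by
    have hmem : ∀ g ∈ A, g p ∈ G p := fun g hg => hA hg p (Set.mem_univ p)
    rcases hG p with h | ⟨a, h⟩
    · exact ⟨0, Or.inr (octahedral_eq_integralSO ▸ h ▸ hmem)⟩
    · exact ⟨a, Or.inl (dihedral_eq_axisStabilizer a ▸ h ▸ hmem)⟩
  choose a ha using hloc
  exact isCompactLieGroup_of_mem_axisStabilizer_or_mem_integralSO ha hcl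

end Stabilizer

end

theorem mainTheorem3 {P : Type*} [Fintype P] [DecidableEq P]
    (L : Submodule (ZMod 2) (P → V)) (hL : IsIsotropic L)
    (hzero : ¬ HasZeroFactor L) (hBell : ¬ HasBellFactor L) (σ : PauliSection L) :
    Group.IsSolvable (autGroup σ) ∧ IsCompactLieGroup (autGroup σ) ∧
    IsClosed (autGroup σ : Set (P → SO3)) ∧
    ∃ G : P → Subgroup SO3, (∀ p, G p = octahedral ∨ ∃ a, G p = dihedral a) ∧
      autGroup σ ≤ Subgroup.pi Set.univ G := by
  obtain ⟨G, hG, hle⟩ := exists_autGroup_le_pi hL hzero hBell σ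
  have hclosed := isClosed_autGroup σ
  have hsolv : ∀ p, Group.IsSolvable (G p) := fun p => by
    rcases hG p with h | ⟨a, h⟩ <;> rw [h]
    exacts [isSolvable_octahedral, isSolvable_dihedral a]
  exact ⟨isSolvable_of_le_pi hsolv hle, isCompactLieGroup_of_le_pi hclosed hG hle, hclosed, G, hG,
    hle⟩
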